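/- Let $\mathfrak p_1=2<\mathfrak p_2=3<\dots$ be the primes and write $\mathfrak p^{\alpha}=\prod_j \mathfrak p_j^{\alpha_j}$, $z^\alpha=\prod_j z_j^{\alpha_j}$ for finitely supported multi-indices $\alpha\in\mathbb N_0^{(\mathbb N)}$. Let $\mathcal H^2$ be the completion of the Dirichlet polynomials $\sum_{n\le M} a_n n^{-s}$ under the norm $\lim_{R\to\infty}\big(\frac1{2R}\int_{-R}^{R}|\sum_{n\le M} a_n n^{-it}|^2dt\big)^{1/2}$, regarded as a space of Dirichlet series through the coefficients. For $k\in\mathbb N=\{1,2,\dots\}$ let $$\mathcal H^2_k=\Big\{\sum a_n n^{-s}:\ \sum \tfrac{a_n}{n^{1/k}}n^{-s}\in\mathcal H^2\Big\},\qquad \Big\|\sum a_n n^{-s}\Big\|_{2,k}=\Big\|\sum \tfrac{a_n}{n^{1/k}}n^{-s}\Big\|_{\mathcal H^2}.$$ Let $\mathcal H_+$ be the space of those Dirichlet series $\sum a_nn^{-s}$ that converge at some point and satisfy $\inf\{\sigma\in\mathbb R: \sum \frac{a_n}{n^{\sigma}}n^{-s}\in\mathcal H^2\}\le 0$, with the topology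 defined by the seminorms $\|\cdot\|_{2,k}$, $k\in\mathbb N$. Let $\ell_2(\mathfrak p^{1/k})$ be the space of complex sequences $z$ with $\big(\sum_j|z_j\mathfrak p_j^{1/k}|^2\big)^{1/2}<\infty$, with this norm, let $B_{\ell_\infty(\mathfrak p^{1/k})}=\{z\in\mathbb C^{\mathbb N}:\sup_j|z_j\mathfrak p_j^{1/k}|<1\}$, and let $\Omega_k=\ell_2(\mathfrak p^{1/k})\cap B_{\ell_\infty(\mathfrak p^{1/k})}$, an open subset of $\ell_2(\mathfrak p^{1/k})$; note that $\Omega_1\subseteq\Omega_2\subseteq\cdots$. Let $H^2(\Omega_k)$ be the space of holomorphic (i.e. Fréchet differentiable at every point) functions $f:\Omega_k\to\mathbb C$ with $$\|f\|=\sup_{N\ge1}\ \sup_{0<r_j<\mathfrak p_j^{-1/k},\,1\le j\le N}\Big(\int_{\mathbb T^N}|f(r_1z_1,\dots,r_Nz_N,0,0,\dots)|^2dz\Big)^{1/2}<\infty,$$ where $dz$ is the normalized Lebesgue measure on $\mathbb T^N$. The monomial coefficients of $f$ are the unique numbers $c_\alpha(f)$ with $f(z)=\sum_\alpha c_\alpha(f)z^\alpha$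 for every finitely supported $z\in\Omega_k$. (i) For every $k\in\mathbb N$, $\mathcal H^2_k=H^2(\Omega_k)$ as Banach spaces: both are complete, and there is a linear isometric bijection $\mathcal H^2_k\to H^2(\Omega_k)$ that sends $\sum a_nn^{-s}$ to a function $f$ with $c_\alpha(f)=a_{\mathfrak p^\alpha}$ for all $\alpha$. (ii) $\mathcal H_+=\bigcap_{k=1}^\infty H^2(\Omega_k)$, where the intersection is the space of functions on $\bigcup_k\Omega_k$ whose restriction to $\Omega_k$ belongs to $H^2(\Omega_k)$ for every $k$, with the topology of the projective limit (the coarsest topology for which all the restriction maps into the spaces $H^2(\Omega_k)$ are continuous). That is, there is a linear homeomorphism from $\mathcal H_+$ onto this intersection that sends $\sum a_nn^{-s}$ to a function $f$ with $c_\alpha(f|_{\Omega_k})=a_{\mathfrak p^\alpha}$ and $\|f|_{\Omega_k}\|=\|\sum a_nn^{-s}\|_{2,k}$ for all $\alpha$ and $k$. -/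

import Mathlib

open Filter Topology MeasureTheory
open scoped ENNReal

noncomputable section

/-- Dirichlet polynomials `∑ aₙ n⁻ˢ`, given by their finitely many nonzero coefficients. -/
def DirichletPoly : Type := ℕ+ →₀ ℂ

namespace DirichletPoly

instance : AddCommGroup DirichletPoly := inferInstanceAs (AddCommGroup (ℕ+ →₀ ℂ))
instance : Module ℂ DirichletPoly := inferInstanceAs (Module ℂ (ℕ+ →₀ ℂ))

/-- The linear map that reads off the coefficients of a Dirichlet polynomial. -/
def coeffs : DirichletPoly →ₗ[ℂ] (ℕ+ → ℂ) where
  toFun P := fun n => (show ℕ+ →₀ ℂ from P) n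
  map_add' _ _ := rfl
  map_smul' _ _ := rfl

/-- The finite set of indices with nonzero coefficient. -/
def supp (P : DirichletPoly) : Finset ℕ+ := Finsupp.support (show ℕ+ →₀ ℂ from P)

/-- The value `P(s) = ∑ aₙ n⁻ˢ`. -/
def eval (P : DirichletPoly) (s : ℂ) : ℂ := ∑ n ∈ P.supp, coeffs P n * (n : ℂ) ^ (-s)

/-- `(1/(2R) ∫_{-R}^{R} |P(it)|² dt)^{1/2}`. -/
def meanSq (P : DirichletPoly) (R : ℝ) : ℝ :=
  ((1 / (2 * R)) * ∫ t in (-R)..R, ‖P.eval (Complex.I * t)‖ ^ 2) ^ (1 / 2 : ℝ)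

/-- The norm of `𝓗²` on Dirichlet polynomials: the limit of `meanSq P R` as `R → ∞`. -/
instance : Norm DirichletPoly := ⟨fun P => limUnder atTop P.meanSq⟩

lemma norm_def (P : DirichletPoly) : ‖P‖ = limUnder atTop P.meanSq := rfl

lemma coeffs_injective : Function.Injective coeffs := fun P Q h =>
  DFunLike.coe_injective (F := ℕ+ →₀ ℂ) (a₁ := P) (a₂ := Q) h

lemma tendsto_mean_exp (ω : ℝ) :
    Tendsto (fun R : ℝ => (1 / (2 * R) : ℂ) * ∫ t in (-R)..R, Complex.exp (Complex.I * ω * t))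
      atTop (𝓝 (if ω = 0 then 1 else 0)) := by
  split_ifs with h
  · subst h
    refine tendsto_const_nhds.congr' ?_
    filter_upwards [eventually_gt_atTop 0] with R hR
    have : (R : ℂ) ≠ 0 := by exact_mod_cast hR.ne'
    simp
    field_simp
    norm_num
  · have hc : Complex.I * ω ≠ 0 := by simp [h]
    have hb : ∀ R : ℝ, 0 < R → ‖(1 / (2 * R) : ℂ) * ∫ t in (-R)..R, Complex.exp (Complex.I * ω * t)‖
        ≤ |ω|⁻¹ * R⁻¹ := by
      intro R hR
      rw [integral_exp_mul_complex hc, norm_mul, norm_div, norm_div]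
      have e : ∀ x : ℝ, ‖Complex.exp (Complex.I * ω * x)‖ = 1 := by
        intro x
        have := Complex.norm_exp_ofReal_mul_I (ω * x)
        rw [← this]; congr 2; push_cast; ring
      have := norm_sub_le (Complex.exp (Complex.I * ω * R)) (Complex.exp (Complex.I * ω * (-R : ℝ)))
      rw [e, e] at this
      simp only [norm_mul, Complex.norm_I, Complex.norm_real, Real.norm_eq_abs, norm_one,
        Complex.norm_ofNat, abs_of_pos hR, one_mul]
      have hw : 0 < |ω| := abs_pos.mpr h
      calc _ ≤ 1 / (2 * R) * ((1 + 1) / |ω|) := by gcongr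
        _ = _ := by field_simp; norm_num
    refine squeeze_zero_norm' (a := fun R => |ω|⁻¹ * R⁻¹) ?_ ?_
    · filter_upwards [eventually_gt_atTop 0] with R hR using hb R hR
    · simpa using tendsto_inv_atTop_zero.const_mul (|ω|⁻¹)

lemma tendsto_meanSq (P : DirichletPoly) :
    Tendsto P.meanSq atTop (𝓝 ((∑ n ∈ P.supp, ‖coeffs P n‖ ^ 2) ^ (1 / 2 : ℝ))) := by
  have key : Tendsto (fun R : ℝ => (1 / (2 * R)) * ∫ t in (-R)..R, ‖P.eval (Complex.I * t)‖ ^ 2)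
      atTop (𝓝 (∑ n ∈ P.supp, ‖coeffs P n‖ ^ 2)) := by
    rw [← Filter.tendsto_ofReal_iff]
    have hpow : ∀ (n : ℕ+) (t : ℝ), (n : ℂ) ^ (-(Complex.I * t)) =
        Complex.exp (Complex.I * (-Real.log n : ℝ) * t) := by
      intro n t
      rw [Complex.cpow_def_of_ne_zero (by exact_mod_cast n.pos.ne'), ← Complex.natCast_log]
      congr 1; push_cast; ring
    have hexp : ∀ t : ℝ, ((‖P.eval (Complex.I * t)‖ ^ 2 : ℝ) : ℂ) = ∑ n ∈ P.supp, ∑ m ∈ P.supp,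
        coeffs P n * (starRingEnd ℂ) (coeffs P m) *
          Complex.exp (Complex.I * (Real.log m - Real.log n : ℝ) * t) := by
      intro t
      rw [← Complex.normSq_eq_norm_sq, ← Complex.mul_conj, eval, map_sum, Finset.sum_mul_sum]
      refine Finset.sum_congr rfl fun n _ => Finset.sum_congr rfl fun m _ => ?_
      rw [hpow, hpow, map_mul, ← Complex.exp_conj, mul_mul_mul_comm, ← Complex.exp_add]
      congr 2
      simp only [map_mul, Complex.conj_I, Complex.conj_ofReal]
      push_cast
      ring
    have hint : ∀ R : ℝ, (((1 / (2 * R)) * ∫ t in (-R)..R, ‖P.eval (Complex.I * t)‖ ^ 2 : ℝ) : ℂ)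
        = ∑ n ∈ P.supp, ∑ m ∈ P.supp, coeffs P n * (starRingEnd ℂ) (coeffs P m) *
          ((1 / (2 * R) : ℂ) * ∫ t in (-R)..R,
            Complex.exp (Complex.I * (Real.log m - Real.log n : ℝ) * t)) := by
      intro R
      rw [Complex.ofReal_mul, ← intervalIntegral.integral_ofReal]
      simp_rw [hexp]
      rw [intervalIntegral.integral_finsetSum, Finset.mul_sum]
      · refine Finset.sum_congr rfl fun n _ => ?_
        rw [intervalIntegral.integral_finsetSum, Finset.mul_sum]
        · refine Finset.sum_congr rfl fun m _ => ?_
          rw [intervalIntegral.integral_const_mul]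
          push_cast; ring
        · intro m _
          exact Continuous.intervalIntegrable (by fun_prop) _ _
      · intro n _
        exact Continuous.intervalIntegrable (by fun_prop) _ _
    refine Tendsto.congr (fun R => (hint R).symm) ?_
    have : ((∑ n ∈ P.supp, ‖coeffs P n‖ ^ 2 : ℝ) : ℂ) = ∑ n ∈ P.supp, ∑ m ∈ P.supp,
        coeffs P n * (starRingEnd ℂ) (coeffs P m) *
          (if Real.log m - Real.log n = 0 then 1 else 0) := by
      push_cast
      refine Finset.sum_congr rfl fun n hn => ?_
      rw [Finset.sum_eq_single n]
      · simp [Complex.mul_conj, Complex.normSq_eq_norm_sq]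
      · intro m _ hmn
        rw [if_neg, mul_zero]
        intro h
        apply hmn
        have := Real.log_injOn_pos (Set.mem_Ioi.2 (Nat.cast_pos.2 m.pos))
          (Set.mem_Ioi.2 (Nat.cast_pos.2 n.pos)) (sub_eq_zero.mp h)
        exact_mod_cast this
      · intro h; exact absurd hn h
    rw [this]
    exact tendsto_finsetSum _ fun n _ => tendsto_finsetSum _ fun m _ =>
      (tendsto_mean_exp _).const_mul _
  exact key.rpow_const (Or.inr (by norm_num))

lemma memlp_coeffs (P : DirichletPoly) : Memℓp (coeffs P) 2 :=
  (memℓp_zero (Set.Finite.subset P.supp.finite_toSet fun n hn =>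
    Finsupp.mem_support_iff.2 hn)).of_exponent_ge (by simp)

/-- The coefficients of a Dirichlet polynomial, as an element of `ℓ²`. -/
def toLp : DirichletPoly →ₗ[ℂ] lp (fun _ : ℕ+ => ℂ) 2 where
  toFun P := ⟨coeffs P, memlp_coeffs P⟩
  map_add' _ _ := rfl
  map_smul' _ _ := rfl

lemma norm_toLp (P : DirichletPoly) : ‖toLp P‖ = ‖P‖ := by
  rw [norm_def, (tendsto_meanSq P).limUnder_eq, lp.norm_eq_tsum_rpow (by simp)]
  simp only [ENNReal.toReal_ofNat, Real.rpow_ofNat]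
  congr 1
  refine tsum_eq_sum fun n hn => ?_
  have : coeffs P n = 0 := Finsupp.notMem_support_iff.1 hn
  change ‖coeffs P n‖ ^ 2 = 0
  simp [this]

lemma normCore : NormedSpace.Core ℂ DirichletPoly where
  norm_nonneg P := by rw [← norm_toLp]; exact norm_nonneg _
  norm_smul c P := by rw [← norm_toLp, map_smul, norm_smul, norm_toLp]
  norm_triangle P Q := by
    rw [← norm_toLp, ← norm_toLp P, ← norm_toLp Q, map_add]; exact norm_add_le _ _
  norm_eq_zero_iff P := by
    rw [← norm_toLp, norm_eq_zero]
    constructor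
    · intro h
      exact coeffs_injective (congrArg Subtype.val h)
    · rintro rfl; exact map_zero _

instance : NormedAddCommGroup DirichletPoly := NormedAddCommGroup.ofCore normCore
instance : NormedSpace ℂ DirichletPoly := NormedSpace.ofCore normCore

end DirichletPoly

/-- The Hardy space `𝓗²`: the completion of the Dirichlet polynomials under the mean-square norm. -/
abbrev DirichletH2 : Type := UniformSpace.Completion DirichletPoly

namespace DirichletH2

/-- The `n`-th coefficient of a Dirichlet polynomial as a bounded functional. -/
def polyCoeff (n : ℕ+) : DirichletPoly →L[ℂ] ℂ :=
  ((LinearMap.proj n).comp DirichletPoly.coeffs).mkContinuous 1 fun P => by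
    rw [one_mul, ← DirichletPoly.norm_toLp]
    exact lp.norm_apply_le_norm (by simp) (DirichletPoly.toLp P) n

/-- The coefficients of an element of `𝓗²`: the continuous extensions to the completion of the
coefficient functionals. -/
def coeffs : DirichletH2 →ₗ[ℂ] (ℕ+ → ℂ) :=
  LinearMap.pi fun n => ((polyCoeff n).extend
    (UniformSpace.Completion.toComplL (𝕜 := ℂ) (E := DirichletPoly))).toLinearMap

lemma isUniformInducing_toComplL :
    IsUniformInducing (UniformSpace.Completion.toComplL (𝕜 := ℂ) (E := DirichletPoly)) :=
  UniformSpace.Completion.isUniformInducing_coe _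

lemma denseRange_toComplL :
    DenseRange (UniformSpace.Completion.toComplL (𝕜 := ℂ) (E := DirichletPoly)) :=
  UniformSpace.Completion.denseRange_coe

lemma coeffs_coe (P : DirichletPoly) (n : ℕ+) :
    coeffs (P : DirichletH2) n = DirichletPoly.coeffs P n :=
  (polyCoeff n).extend_eq denseRange_toComplL isUniformInducing_toComplL P

lemma continuous_coeffs (n : ℕ+) : Continuous fun x => coeffs x n :=
  ((polyCoeff n).extend
    (UniformSpace.Completion.toComplL (𝕜 := ℂ) (E := DirichletPoly))).continuous

/-- The isometry of `𝓗²` into `ℓ²`. -/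
def toLpCLM : DirichletH2 →L[ℂ] lp (fun _ : ℕ+ => ℂ) 2 :=
  (DirichletPoly.toLp.mkContinuous 1 fun P => by
    rw [one_mul, DirichletPoly.norm_toLp]).extend
      (UniformSpace.Completion.toComplL (𝕜 := ℂ) (E := DirichletPoly))

lemma toLpCLM_coe (P : DirichletPoly) : toLpCLM (P : DirichletH2) = DirichletPoly.toLp P :=
  ContinuousLinearMap.extend_eq _ denseRange_toComplL isUniformInducing_toComplL P

lemma norm_toLpCLM (x : DirichletH2) : ‖toLpCLM x‖ = ‖x‖ := by
  induction x using UniformSpace.Completion.induction_on with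
  | hp => exact isClosed_eq (by fun_prop) (by fun_prop)
  | ih P => rw [toLpCLM_coe, DirichletPoly.norm_toLp, UniformSpace.Completion.norm_coe]

lemma toLpCLM_apply (x : DirichletH2) (n : ℕ+) : (toLpCLM x : ℕ+ → ℂ) n = coeffs x n := by
  induction x using UniformSpace.Completion.induction_on with
  | hp =>
    refine isClosed_eq ?_ (continuous_coeffs n)
    exact (lp.evalCLM ℂ (fun _ : ℕ+ => ℂ) 2 n).continuous.comp toLpCLM.continuous
  | ih P => rw [toLpCLM_coe, coeffs_coe]; rfl

lemma coeffs_injective : Function.Injective coeffs := by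
  intro x y h
  have : toLpCLM x = toLpCLM y := by
    ext n; rw [toLpCLM_apply, toLpCLM_apply, h]
  rw [← sub_eq_zero, ← norm_eq_zero, ← norm_toLpCLM, map_sub, this, sub_self, norm_zero]

lemma toLpCLM_surjective : Function.Surjective toLpCLM := by
  have hiso : Isometry toLpCLM := AddMonoidHomClass.isometry_of_norm _ norm_toLpCLM
  have hcl : IsClosed (Set.range toLpCLM) := hiso.isClosedEmbedding.isClosed_range
  intro y
  have hy := lp.hasSum_single (by simp) y
  refine hcl.mem_of_tendsto hy (Eventually.of_forall fun s => ?_)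
  change _ ∈ LinearMap.range toLpCLM.toLinearMap
  refine Submodule.sum_mem _ fun n _ => 
    ⟨UniformSpace.Completion.coe' (show DirichletPoly from (Finsupp.single n (y n) : ℕ+ →₀ ℂ)), ?_⟩
  change toLpCLM _ = _
  rw [toLpCLM_coe]
  ext m
  change (Finsupp.single n (y n) : ℕ+ →₀ ℂ) m = _
  rw [Finsupp.single_apply, lp.single_apply, Pi.single_apply]
  simp only [eq_comm]

end DirichletH2

/-- `𝓗²` as a space of (formal) Dirichlet series, which are identified with the sequences of their
coefficients. -/
def h2Series : Submodule ℂ (ℕ+ → ℂ) := LinearMap.range DirichletH2.coeffs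

lemma mem_h2Series_iff (a : ℕ+ → ℂ) : a ∈ h2Series ↔ Memℓp a 2 := by
  constructor
  · rintro ⟨x, rfl⟩
    have : DirichletH2.coeffs x = (DirichletH2.toLpCLM x : ℕ+ → ℂ) :=
      funext fun n => (DirichletH2.toLpCLM_apply x n).symm
    rw [this]
    exact (DirichletH2.toLpCLM x).2
  · intro h
    obtain ⟨x, hx⟩ := DirichletH2.toLpCLM_surjective ⟨a, h⟩
    exact ⟨x, funext fun n => by rw [← DirichletH2.toLpCLM_apply, hx]⟩

/-- The translation `∑ aₙ n⁻ˢ ↦ ∑ (aₙ / n^σ) n⁻ˢ`. -/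
def shiftSeries (σ : ℝ) : (ℕ+ → ℂ) →ₗ[ℂ] (ℕ+ → ℂ) where
  toFun a := fun n => a n / (((n : ℝ) ^ σ : ℝ) : ℂ)
  map_add' a b := by ext n; simp [add_div]
  map_smul' c a := by ext n; simp [mul_div_assoc]

lemma shiftSeries_injective (σ : ℝ) : Function.Injective (shiftSeries σ) := by
  intro a b h
  ext n
  have hn : (((n : ℝ) ^ σ : ℝ) : ℂ) ≠ 0 := by
    exact_mod_cast (Real.rpow_pos_of_pos (Nat.cast_pos.2 n.pos) σ).ne'
  exact (div_left_inj' hn).1 (congrFun h n)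

/-- The Dirichlet series `∑ aₙ n⁻ˢ` with `∑ (aₙ / n^{1/k}) n⁻ˢ` in `𝓗²`. -/
def h2kSeries (k : ℕ+) : Submodule ℂ (ℕ+ → ℂ) := h2Series.comap (shiftSeries (1 / (k : ℝ)))

/-- The space `𝓗²ₖ` of Dirichlet series, with the norm
`‖∑ aₙ n⁻ˢ‖_{2,k} = ‖∑ (aₙ / n^{1/k}) n⁻ˢ‖_{𝓗²}`. -/
def DirichletH2k (k : ℕ+) : Type := h2kSeries k

namespace DirichletH2k

instance (k : ℕ+) : AddCommGroup (DirichletH2k k) := inferInstanceAs (AddCommGroup (h2kSeries k))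
instance (k : ℕ+) : Module ℂ (DirichletH2k k) := inferInstanceAs (Module ℂ (h2kSeries k))

/-- The coefficients of a series in `𝓗²ₖ`. -/
def coeffs (k : ℕ+) : DirichletH2k k →ₗ[ℂ] (ℕ+ → ℂ) := (h2kSeries k).subtype

/-- The translation `𝓗²ₖ → 𝓗²`, `∑ aₙ n⁻ˢ ↦ ∑ (aₙ / n^{1/k}) n⁻ˢ`. -/
def toH2 (k : ℕ+) : DirichletH2k k →ₗ[ℂ] DirichletH2 :=
  (LinearEquiv.ofInjective DirichletH2.coeffs DirichletH2.coeffs_injective).symm.toLinearMap ∘ₗ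
    (shiftSeries (1 / (k : ℝ))).restrict (p := h2kSeries k) (q := h2Series) fun _ h => h

lemma toH2_injective (k : ℕ+) : Function.Injective (toH2 k) := by
  intro a b h
  have h' := (LinearEquiv.ofInjective DirichletH2.coeffs
    DirichletH2.coeffs_injective).symm.injective h
  exact Subtype.ext (shiftSeries_injective _ (congrArg Subtype.val h'))

instance (k : ℕ+) : NormedAddCommGroup (DirichletH2k k) :=
  NormedAddCommGroup.induced (DirichletH2k k) DirichletH2 (toH2 k) (toH2_injective k)

instance (k : ℕ+) : NormedSpace ℂ (DirichletH2k k) := NormedSpace.induced ℂ _ _ (toH2 k)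

end DirichletH2k

/-- The Dirichlet series `∑ aₙ n⁻ˢ` that converge at some point `s`. -/
def ConvergesSomewhere (a : ℕ+ → ℂ) : Prop :=
  ∃ s l : ℂ, Tendsto (fun N : ℕ => ∑ n ∈ Finset.range N, a n.succPNat * (n.succPNat : ℂ) ^ (-s))
    atTop (𝓝 l)

/-- The `𝓗²`-abscissa: the infimum of the real `σ` with `∑ (aₙ / n^σ) n⁻ˢ` in `𝓗²`, as an
extended real number (so `⊤` if there is no such `σ`). -/
def h2Abscissa (a : ℕ+ → ℂ) : EReal := ⨅ (σ : ℝ) (_ : shiftSeries σ a ∈ h2Series), (σ : EReal)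

lemma shiftSeries_mem_of_le {a : ℕ+ → ℂ} {σ τ : ℝ} (h : σ ≤ τ) (ha : shiftSeries σ a ∈ h2Series) :
    shiftSeries τ a ∈ h2Series := by
  rw [mem_h2Series_iff] at ha ⊢
  refine ha.mono' fun n => ?_
  change ‖a n / _‖ ≤ ‖a n / _‖
  have hn : (1 : ℝ) ≤ n := by exact_mod_cast n.pos
  rw [norm_div, norm_div, Complex.norm_real, Complex.norm_real,
    Real.norm_of_nonneg (by positivity), Real.norm_of_nonneg (by positivity)]
  gcongr

lemma convergesSomewhere_of_shiftSeries_mem {a : ℕ+ → ℂ} {σ : ℝ} (ha : shiftSeries σ a ∈ h2Series) :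
    ConvergesSomewhere a := by
  rw [mem_h2Series_iff, memℓp_gen_iff (by simp)] at ha
  simp only [ENNReal.toReal_ofNat, Real.rpow_ofNat] at ha
  have ha' := (Equiv.pnatEquivNat.symm.summable_iff).2 ha
  have h2 : Summable fun n : ℕ => (((n + 1 : ℕ) : ℝ) ^ 2)⁻¹ :=
    (summable_nat_add_iff 1).2 (Real.summable_nat_pow_inv.2 (by norm_num))
  have hs : Summable fun n : ℕ => a n.succPNat * (n.succPNat : ℂ) ^ (-((σ + 1 : ℝ) : ℂ)) := by
    refine Summable.of_norm_bounded (ha'.add h2) fun n => ?_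
    have hpos : (0 : ℝ) < (n.succPNat : ℕ) := Nat.cast_pos.2 n.succPNat.pos
    change ‖_‖ ≤ ‖shiftSeries σ a n.succPNat‖ ^ 2 + (((n + 1 : ℕ) : ℝ) ^ 2)⁻¹
    have e : ‖a n.succPNat * (n.succPNat : ℂ) ^ (-((σ + 1 : ℝ) : ℂ))‖ =
        ‖shiftSeries σ a n.succPNat‖ * ((n + 1 : ℕ) : ℝ)⁻¹ := by
      change _ = ‖a n.succPNat / _‖ * _
      rw [norm_mul, norm_div, Complex.norm_real, Real.norm_of_nonneg (by positivity),
        Complex.norm_natCast_cpow_of_pos n.succPNat.pos]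
      have : (-((σ + 1 : ℝ) : ℂ)).re = -σ + -1 := by simp; ring
      rw [this, Real.rpow_add hpos, Real.rpow_neg hpos.le, Real.rpow_neg_one]
      simp only [Nat.succPNat_coe, Nat.succ_eq_add_one]
      ring
    rw [e]
    have := two_mul_le_add_sq ‖shiftSeries σ a n.succPNat‖ (((n + 1 : ℕ) : ℝ)⁻¹)
    have h3 : 0 ≤ ‖shiftSeries σ a n.succPNat‖ * ((n + 1 : ℕ) : ℝ)⁻¹ := by positivity
    rw [inv_pow] at this
    linarith
  exact ⟨_, _, hs.hasSum.tendsto_sum_nat⟩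

lemma hplus_iff (a : ℕ+ → ℂ) :
    (ConvergesSomewhere a ∧ h2Abscissa a ≤ 0) ↔ a ∈ ⨅ k : ℕ+, h2kSeries k := by
  rw [Submodule.mem_iInf]
  constructor
  · rintro ⟨-, h⟩ k
    have hk : (0 : EReal) < ((1 / (k : ℝ) : ℝ) : EReal) := by
      have : (0 : ℝ) < k := Nat.cast_pos.2 k.pos
      exact_mod_cast (by positivity : (0 : ℝ) < 1 / (k : ℝ))
    have := h.trans_lt hk
    simp only [h2Abscissa, iInf_lt_iff] at this
    obtain ⟨σ, hσ, hlt⟩ := this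
    exact shiftSeries_mem_of_le (EReal.coe_lt_coe_iff.1 hlt).le hσ
  · intro h
    refine ⟨convergesSomewhere_of_shiftSeries_mem (h 1), ?_⟩
    refine le_of_forall_gt fun c hc => ?_
    obtain ⟨ε, hε, hεc⟩ := EReal.lt_iff_exists_real_btwn.1 hc
    obtain ⟨k, hk⟩ := exists_nat_one_div_lt (EReal.coe_pos.1 hε)
    refine lt_of_le_of_lt (iInf₂_le (1 / ((k.succPNat : ℕ+) : ℝ)) (h k.succPNat)) ?_
    refine lt_trans ?_ hεc
    rw [EReal.coe_lt_coe_iff]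
    simpa using hk

/-- The vector space underlying `𝓗₊`: the Dirichlet series that converge somewhere and whose
`𝓗²`-abscissa is at most `0`. -/
def hplusSeries : Submodule ℂ (ℕ+ → ℂ) where
  carrier := {a | ConvergesSomewhere a ∧ h2Abscissa a ≤ 0}
  add_mem' {a b} ha hb := (hplus_iff _).2 (add_mem ((hplus_iff a).1 ha) ((hplus_iff b).1 hb))
  zero_mem' := (hplus_iff _).2 (zero_mem _)
  smul_mem' c a ha := (hplus_iff _).2 (Submodule.smul_mem _ c ((hplus_iff a).1 ha))

lemma hplusSeries_le (k : ℕ+) : hplusSeries ≤ h2kSeries k := fun a ha =>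
  (Submodule.mem_iInf _).1 ((hplus_iff a).1 ha) k

/-- The space `𝓗₊` of Dirichlet series, with the topology defined by the seminorms
`‖·‖_{2,k}`, `k ≥ 1`. -/
def HPlus : Type := hplusSeries

namespace HPlus

instance : AddCommGroup HPlus := inferInstanceAs (AddCommGroup hplusSeries)
instance : Module ℂ HPlus := inferInstanceAs (Module ℂ hplusSeries)

/-- The coefficients of a series in `𝓗₊`. -/
def coeffs : HPlus →ₗ[ℂ] (ℕ+ → ℂ) := hplusSeries.subtype

/-- The inclusion `𝓗₊ ⊆ 𝓗²ₖ`. -/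
def incl (k : ℕ+) : HPlus →ₗ[ℂ] DirichletH2k k := Submodule.inclusion (hplusSeries_le k)

/-- The seminorms `‖·‖_{2,k}` on `𝓗₊`. -/
def seminorms : SeminormFamily ℂ HPlus ℕ+ := fun k => (normSeminorm ℂ (DirichletH2k k)).comp (incl k)

instance : TopologicalSpace HPlus := seminorms.moduleFilterBasis.topology

end HPlus

/-- The sequence `𝔭₁ = 2, 𝔭₂ = 3, …` of the primes; indices start at `0` here. -/
def primeSeq (j : ℕ) : ℕ := Nat.nth Nat.Prime j

lemma primeSeq_pos (j : ℕ) : 0 < primeSeq j :=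
  (Nat.nth_mem_of_infinite Nat.infinite_setOfPred_prime j).pos

/-- The weight `𝔭ⱼ^{1/k}`. -/
def weight (k : ℕ+) (j : ℕ) : ℝ := (primeSeq j : ℝ) ^ (1 / (k : ℝ))

lemma weight_pos (k : ℕ+) (j : ℕ) : 0 < weight k j :=
  Real.rpow_pos_of_pos (Nat.cast_pos.2 (primeSeq_pos j)) _

/-- The number `𝔭^α = ∏ 𝔭ⱼ^{αⱼ}`. -/
def primePow (α : ℕ →₀ ℕ) : ℕ+ :=
  ⟨α.prod fun j m => primeSeq j ^ m, Finset.prod_pos fun j _ => pow_pos (primeSeq_pos j) _⟩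

/-- The diagonal map `z ↦ (zⱼ 𝔭ⱼ^{1/k})ⱼ`. -/
def weightMul (k : ℕ+) : (ℕ → ℂ) →ₗ[ℂ] (ℕ → ℂ) where
  toFun z := fun j => z j * weight k j
  map_add' z w := by ext j; simp [add_mul]
  map_smul' c z := by ext j; simp [mul_assoc]

lemma weightMul_injective (k : ℕ+) : Function.Injective (weightMul k) := by
  intro z w h
  ext j
  have : (weight k j : ℂ) ≠ 0 := by exact_mod_cast (weight_pos k j).ne'
  exact mul_right_cancel₀ this (congrFun h j)

/-- The vector space underlying `ℓ₂(𝔭^{1/k})`. -/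
def wl2 (k : ℕ+) : Submodule ℂ (ℕ → ℂ) where
  carrier := {z | Memℓp (weightMul k z) 2}
  add_mem' {z w} hz hw := by
    change Memℓp (weightMul k (z + w)) 2
    rw [map_add]; exact Memℓp.add hz hw
  zero_mem' := by
    change Memℓp (weightMul k 0) 2
    rw [map_zero]; exact zero_memℓp
  smul_mem' c z hz := by
    change Memℓp (weightMul k (c • z)) 2
    rw [map_smul]; exact Memℓp.const_smul hz c

/-- The Banach sequence space `ℓ₂(𝔭^{1/k})`, with the norm `(∑ |zⱼ 𝔭ⱼ^{1/k}|²)^{1/2}`. -/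
def WeightedL2 (k : ℕ+) : Type := wl2 k

namespace WeightedL2

instance (k : ℕ+) : AddCommGroup (WeightedL2 k) := inferInstanceAs (AddCommGroup (wl2 k))
instance (k : ℕ+) : Module ℂ (WeightedL2 k) := inferInstanceAs (Module ℂ (wl2 k))

/-- The sequence underlying an element of `ℓ₂(𝔭^{1/k})`. -/
def seq (k : ℕ+) : WeightedL2 k →ₗ[ℂ] (ℕ → ℂ) := (wl2 k).subtype

/-- The map `z ↦ (zⱼ 𝔭ⱼ^{1/k})ⱼ` from `ℓ₂(𝔭^{1/k})` to `ℓ₂`, which defines the norm. -/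
def toLp (k : ℕ+) : WeightedL2 k →ₗ[ℂ] lp (fun _ : ℕ => ℂ) 2 where
  toFun z := ⟨weightMul k (seq k z), z.2⟩
  map_add' z w := Subtype.ext (by
    change weightMul k (seq k (z + w)) = weightMul k (seq k z) + weightMul k (seq k w)
    simp only [map_add])
  map_smul' c z := Subtype.ext (by
    change weightMul k (seq k (c • z)) = c • weightMul k (seq k z)
    simp only [map_smul])

lemma toLp_injective (k : ℕ+) : Function.Injective (toLp k) := fun _ _ h =>
  Subtype.ext (weightMul_injective k (congrArg Subtype.val h))

instance (k : ℕ+) : NormedAddCommGroup (WeightedL2 k) :=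
  NormedAddCommGroup.induced (WeightedL2 k) (lp (fun _ : ℕ => ℂ) 2) (toLp k) (toLp_injective k)

instance (k : ℕ+) : NormedSpace ℂ (WeightedL2 k) := NormedSpace.induced ℂ _ _ (toLp k)

end WeightedL2

/-- The open unit ball of `ℓ_∞(𝔭^{1/k})`. -/
def weightedBall (k : ℕ+) : Set (ℕ → ℂ) :=
  {z | BddAbove (Set.range fun j => ‖z j * weight k j‖) ∧ ⨆ j, ‖z j * weight k j‖ < 1}

/-- The domain `ℓ₂(𝔭^{1/k}) ∩ B_{ℓ_∞(𝔭^{1/k})}`. -/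
def Omega (k : ℕ+) : Set (ℕ → ℂ) := wl2 k ∩ weightedBall k

/-- Extension by zero of a function on a set of sequences. -/
def zeroExt {S : Set (ℕ → ℂ)} (f : S → ℂ) : (ℕ → ℂ) → ℂ := Function.extend Subtype.val f 0

/-- Holomorphy: Fréchet differentiability at every point of `Omega k` with respect to the norm of
`ℓ₂(𝔭^{1/k})`, in which `Omega k` is open. -/
def IsHolomorphic (k : ℕ+) (f : Omega k → ℂ) : Prop :=
  ∀ z : WeightedL2 k, WeightedL2.seq k z ∈ Omega k →
    DifferentiableAt ℂ (fun w : WeightedL2 k => zeroExt f (WeightedL2.seq k w)) z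

/-- The embedding `(w₁, …, w_N) ↦ (w₁, …, w_N, 0, 0, …)`. -/
def padZero (N : ℕ) : (Fin N → ℂ) →ₗ[ℂ] (ℕ → ℂ) where
  toFun w := fun j => if h : j < N then w ⟨j, h⟩ else 0
  map_add' v w := by ext j; by_cases h : j < N <;> simp [h]
  map_smul' c w := by ext j; by_cases h : j < N <;> simp [h]

/-- The function `(z₁, …, z_N) ↦ f(r₁ z₁, …, r_N z_N, 0, 0, …)` on `𝕋^N`, where `𝕋` is
parametrized by `ℝ / ℤ` through `t ↦ e^{2π i t}`. -/
def onTorus {S : Set (ℕ → ℂ)} (f : S → ℂ) (N : ℕ) (r : Fin N → ℝ) (t : Fin N → UnitAddCircle) : ℂ :=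
  zeroExt f (padZero N fun j => (r j : ℂ) * ((t j).toCircle : ℂ))

/-- The norm of `H²(ℓ₂(𝔭^{1/k}) ∩ B_{ℓ_∞(𝔭^{1/k})})` as an extended real number: the supremum over
`N ≥ 1` and `0 < rⱼ < 𝔭ⱼ^{-1/k}` of the `L²`-norms of `(z₁, …, z_N) ↦ f(r₁ z₁, …, r_N z_N, 0, …)`
with respect to the normalized Lebesgue measure of `𝕋^N`. -/
def hardyENorm (k : ℕ+) (f : Omega k → ℂ) : ℝ≥0∞ :=
  ⨆ (N : ℕ) (_ : 1 ≤ N) (r : Fin N → ℝ) (_ : ∀ j, 0 < r j ∧ r j < (weight k j)⁻¹),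
    eLpNorm (onTorus f N r) 2 (Measure.pi fun _ : Fin N => AddCircle.haarAddCircle)

lemma zeroExt_apply {S : Set (ℕ → ℂ)} (f : S → ℂ) (z : S) : zeroExt f z = f z :=
  Subtype.val_injective.extend_apply f 0 z

lemma zeroExt_zero {S : Set (ℕ → ℂ)} : zeroExt (0 : S → ℂ) = 0 := by
  unfold zeroExt
  ext z
  by_cases h : ∃ a : S, a.1 = z
  · obtain ⟨a, rfl⟩ := h
    rw [Subtype.val_injective.extend_apply]; rfl
  · rw [Function.extend_apply' _ _ _ h]

lemma zeroExt_add {S : Set (ℕ → ℂ)} (f g : S → ℂ) :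
    zeroExt (f + g) = zeroExt f + zeroExt g := by
  unfold zeroExt
  ext z
  by_cases h : ∃ a : S, a.1 = z
  · obtain ⟨a, rfl⟩ := h
    simp only [Pi.add_apply, Subtype.val_injective.extend_apply]
  · simp only [Pi.add_apply, Function.extend_apply' _ _ _ h, Pi.zero_apply, add_zero]

lemma zeroExt_smul {S : Set (ℕ → ℂ)} (c : ℂ) (f : S → ℂ) :
    zeroExt (c • f) = c • zeroExt f := by
  unfold zeroExt
  ext z
  by_cases h : ∃ a : S, a.1 = z
  · obtain ⟨a, rfl⟩ := h
    simp only [Pi.smul_apply, Subtype.val_injective.extend_apply]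
  · simp only [Pi.smul_apply, Function.extend_apply' _ _ _ h, Pi.zero_apply, smul_zero]

lemma padZero_mem_wl2 (k : ℕ+) {N : ℕ} (w : Fin N → ℂ) : padZero N w ∈ wl2 k := by
  refine (memℓp_zero (Set.Finite.subset (Set.finite_lt_nat N) fun j hj => ?_)).of_exponent_ge
    (by simp)
  by_contra h
  apply hj
  have h' : ¬ j < N := h
  simp [weightMul, padZero, h']

/-- The embedding of `ℂ^N` into `ℓ₂(𝔭^{1/k})`. -/
def padL2 (k : ℕ+) (N : ℕ) : (Fin N → ℂ) →ₗ[ℂ] WeightedL2 k :=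
  (padZero N).codRestrict (wl2 k) (padZero_mem_wl2 k)

lemma seq_padL2 (k : ℕ+) {N : ℕ} (w : Fin N → ℂ) :
    WeightedL2.seq k (padL2 k N w) = padZero N w := rfl

lemma norm_lt_one_of_mem_Omega {k : ℕ+} {z : ℕ → ℂ} (hz : z ∈ Omega k) (j : ℕ) :
    ‖z j * weight k j‖ < 1 :=
  (le_ciSup hz.2.1 j).trans_lt hz.2.2

lemma padZero_mem_Omega {k : ℕ+} {N : ℕ} {w : Fin N → ℂ} (hw : ∀ j, ‖w j * weight k j‖ < 1) :
    padZero N w ∈ Omega k := by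
  obtain ⟨c, hc1, hc0, hc⟩ : ∃ c : ℝ, c < 1 ∧ 0 ≤ c ∧ ∀ j, ‖w j * weight k j‖ ≤ c := by
    rcases isEmpty_or_nonempty (Fin N) with h | h
    · exact ⟨0, by norm_num, le_rfl, fun j => h.elim j⟩
    · obtain ⟨i, hi⟩ := Finite.exists_max fun j => ‖w j * weight k j‖
      exact ⟨_, hw i, norm_nonneg _, hi⟩
  have hb : ∀ j, ‖padZero N w j * weight k j‖ ≤ c := by
    intro j
    by_cases h : j < N
    · simpa [padZero, h] using hc ⟨j, h⟩
    · simpa [padZero, h] using hc0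
  exact ⟨padZero_mem_wl2 k w, ⟨c, Set.forall_mem_range.2 hb⟩, (ciSup_le hb).trans_lt hc1⟩

lemma onTorus_mem {k : ℕ+} {N : ℕ} {r : Fin N → ℝ} (hr : ∀ j, 0 < r j ∧ r j < (weight k j)⁻¹)
    (t : Fin N → UnitAddCircle) :
    padZero N (fun j => (r j : ℂ) * ((t j).toCircle : ℂ)) ∈ Omega k := by
  refine padZero_mem_Omega fun j => ?_
  rw [norm_mul, norm_mul, Complex.norm_real, Complex.norm_real, Circle.norm_coe,
    Real.norm_of_nonneg (hr j).1.le, Real.norm_of_nonneg (weight_pos k j).le, mul_one]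
  have := (hr j).2
  rwa [← one_div, lt_div_iff₀ (weight_pos k j)] at this

lemma continuous_onTorus {k : ℕ+} {f : Omega k → ℂ} (hf : IsHolomorphic k f) {N : ℕ}
    {r : Fin N → ℝ} (hr : ∀ j, 0 < r j ∧ r j < (weight k j)⁻¹) : Continuous (onTorus f N r) := by
  have h1 : Continuous fun t : Fin N → UnitAddCircle =>
      padL2 k N (fun j => (r j : ℂ) * ((t j).toCircle : ℂ)) := by
    refine (LinearMap.continuous_of_finiteDimensional (padL2 k N)).comp ?_
    refine continuous_pi fun j => continuous_const.mul ?_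
    exact continuous_subtype_val.comp (AddCircle.continuous_toCircle.comp (continuous_apply j))
  refine continuous_iff_continuousAt.2 fun t => ?_
  have hm : WeightedL2.seq k (padL2 k N (fun j => (r j : ℂ) * ((t j).toCircle : ℂ))) ∈ Omega k := by
    rw [seq_padL2]; exact onTorus_mem hr t
  have h2 : ContinuousAt (fun w : WeightedL2 k => zeroExt f (WeightedL2.seq k w))
      (padL2 k N (fun j => (r j : ℂ) * ((t j).toCircle : ℂ))) :=
    (hf _ hm).continuousAt
  have h3 := h2.tendsto.comp (h1.tendsto t)
  exact h3

lemma hardyENorm_zero (k : ℕ+) : hardyENorm k 0 = 0 := by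
  have : ∀ (N : ℕ) (r : Fin N → ℝ), onTorus (0 : Omega k → ℂ) N r = 0 := by
    intro N r; ext t; simp [onTorus, zeroExt_zero]
  simp [hardyENorm, this]

lemma hardyENorm_add_le {k : ℕ+} {f g : Omega k → ℂ} (hf : IsHolomorphic k f)
    (hg : IsHolomorphic k g) : hardyENorm k (f + g) ≤ hardyENorm k f + hardyENorm k g := by
  refine iSup₂_le fun N hN => iSup₂_le fun r hr => ?_
  have : onTorus (f + g) N r = onTorus f N r + onTorus g N r := by
    ext t; simp [onTorus, zeroExt_add]
  rw [this]
  refine (eLpNorm_add_le (continuous_onTorus hf hr).aestronglyMeasurable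
    (continuous_onTorus hg hr).aestronglyMeasurable (by norm_num)).trans ?_
  gcongr
  · exact le_iSup₂_of_le N hN (le_iSup₂_of_le r hr le_rfl)
  · exact le_iSup₂_of_le N hN (le_iSup₂_of_le r hr le_rfl)

lemma hardyENorm_smul {k : ℕ+} (c : ℂ) (f : Omega k → ℂ) :
    hardyENorm k (c • f) = ‖c‖ₑ * hardyENorm k f := by
  have : ∀ (N : ℕ) (r : Fin N → ℝ), onTorus (c • f) N r = c • onTorus f N r := by
    intro N r; ext t; simp [onTorus, zeroExt_smul]
  simp only [hardyENorm, this, eLpNorm_const_smul, ENNReal.mul_iSup]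

lemma zeroExt_eq_zero_aux {k : ℕ+} {f : Omega k → ℂ} (hf : IsHolomorphic k f)
    (h : hardyENorm k f = 0) {N : ℕ} (hN : 1 ≤ N) {w : Fin N → ℂ}
    (hw : ∀ j, ‖w j * weight k j‖ < 1) (hw0 : ∀ j, w j ≠ 0) : zeroExt f (padZero N w) = 0 := by
  have hr : ∀ j, 0 < ‖w j‖ ∧ ‖w j‖ < (weight k j)⁻¹ := by
    intro j
    refine ⟨norm_pos_iff.2 (hw0 j), ?_⟩
    rw [← one_div, lt_div_iff₀ (weight_pos k j)]
    simpa [abs_of_pos (weight_pos k j)] using hw j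
  have hle : eLpNorm (onTorus f N fun j => ‖w j‖) 2
      (Measure.pi fun _ : Fin N => AddCircle.haarAddCircle) ≤ hardyENorm k f :=
    le_iSup₂_of_le N hN (le_iSup₂_of_le (fun j => ‖w j‖) hr le_rfl)
  rw [h, nonpos_iff_eq_zero, eLpNorm_eq_zero_iff
    (continuous_onTorus hf hr).aestronglyMeasurable (by norm_num),
    (continuous_onTorus hf hr).ae_eq_iff_eq _ continuous_zero] at hle
  have hsurj : ∀ j, ∃ t : UnitAddCircle, (‖w j‖ : ℂ) * (t.toCircle : ℂ) = w j := by
    intro j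
    refine ⟨((Complex.arg (w j) / (2 * Real.pi) : ℝ) : UnitAddCircle), ?_⟩
    rw [AddCircle.toCircle_apply_mk, Circle.coe_exp]
    have : 2 * Real.pi / 1 * (Complex.arg (w j) / (2 * Real.pi)) = Complex.arg (w j) := by
      field_simp
    rw [this]
    exact Complex.norm_mul_exp_arg_mul_I (w j)
  choose t ht using hsurj
  have := congrFun hle t
  simpa [onTorus, ht] using this

lemma zeroExt_padZero_eq_zero {k : ℕ+} {f : Omega k → ℂ} (hf : IsHolomorphic k f)
    (h : hardyENorm k f = 0) {N : ℕ} (hN : 1 ≤ N) {w : Fin N → ℂ}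
    (hw : ∀ j, ‖w j * weight k j‖ < 1) : zeroExt f (padZero N w) = 0 := by
  set u : Fin N → ℂ := fun j => if w j = 0 then 1 else 0 with hu
  have hlin : Tendsto (fun ε : ℝ => w + (ε : ℂ) • u) (𝓝[>] 0) (𝓝 w) := by
    have : Continuous fun ε : ℝ => w + (ε : ℂ) • u := by fun_prop
    simpa using (this.tendsto 0).mono_left nhdsWithin_le_nhds
  have hm : WeightedL2.seq k (padL2 k N w) ∈ Omega k := by
    rw [seq_padL2]; exact padZero_mem_Omega hw
  have ht := (hf (padL2 k N w) hm).continuousAt.tendsto.comp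
    (((LinearMap.continuous_of_finiteDimensional (padL2 k N)).tendsto w).comp hlin)
  refine tendsto_nhds_unique ht (tendsto_const_nhds.congr' ?_)
  have hev : ∀ᶠ v in 𝓝 w, ∀ j : Fin N, ‖(v j : ℂ) * (weight k j : ℂ)‖ < 1 := by
    rw [eventually_all]
    intro j
    have : Continuous fun v : Fin N → ℂ => ‖v j * weight k j‖ := by fun_prop
    exact (this.tendsto w).eventually_lt_const (hw j)
  filter_upwards [hlin.eventually hev, self_mem_nhdsWithin] with ε hε hε0
  refine (zeroExt_eq_zero_aux hf h hN hε fun j => ?_).symm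
  have : (ε : ℂ) ≠ 0 := by exact_mod_cast (ne_of_gt hε0)
  by_cases hj : w j = 0 <;> simp [hu, hj, this]

lemma eq_zero_of_hardyENorm_eq_zero {k : ℕ+} {f : Omega k → ℂ} (hf : IsHolomorphic k f)
    (h : hardyENorm k f = 0) : f = 0 := by
  ext ⟨z, hz⟩
  have h3 : Tendsto (fun N : ℕ => padL2 k N fun j => z j) atTop
      (𝓝 (show WeightedL2 k from ⟨z, hz.1⟩)) := by
    have hind : IsInducing (WeightedL2.toLp k) := ⟨rfl⟩
    rw [hind.tendsto_nhds_iff]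
    have hs := (lp.hasSum_single (by simp)
      (WeightedL2.toLp k (show WeightedL2 k from ⟨z, hz.1⟩))).tendsto_sum_nat
    refine hs.congr fun N => ?_
    ext i
    rw [lp.coeFn_sum, Finset.sum_apply]
    change _ = padZero N (fun j => z j) i * weight k i
    simp only [lp.single_apply, Pi.single_apply]
    rw [Finset.sum_ite_eq (Finset.range N) i]
    by_cases hi : i < N
    · simp only [Finset.mem_range, hi, if_true, padZero]
      simp [hi]; rfl
    · simp [padZero, hi]
  have hm := hf (show WeightedL2 k from ⟨z, hz.1⟩) hz
  have h4 := hm.continuousAt.tendsto.comp h3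
  have h5 : zeroExt f z = 0 := by
    refine tendsto_nhds_unique h4 (tendsto_const_nhds.congr' ?_)
    filter_upwards [eventually_ge_atTop 1] with N hN
    exact (zeroExt_padZero_eq_zero hf h hN fun j => norm_lt_one_of_mem_Omega hz j).symm
  rw [← zeroExt_apply f ⟨z, hz⟩]
  exact h5

/-- The vector space underlying `H²(ℓ₂(𝔭^{1/k}) ∩ B_{ℓ_∞(𝔭^{1/k})})`. -/
def hardyFunctions (k : ℕ+) : Submodule ℂ (Omega k → ℂ) where
  carrier := {f | IsHolomorphic k f ∧ hardyENorm k f < ∞}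
  add_mem' {f g} hf hg := by
    refine ⟨fun z hz => ?_, (hardyENorm_add_le hf.1 hg.1).trans_lt (ENNReal.add_lt_top.2 ⟨hf.2, hg.2⟩)⟩
    rw [zeroExt_add]
    exact (hf.1 z hz).add (hg.1 z hz)
  zero_mem' := by
    refine ⟨fun z _ => ?_, by rw [hardyENorm_zero]; simp⟩
    rw [zeroExt_zero]
    exact differentiableAt_const 0
  smul_mem' c f hf := by
    refine ⟨fun z hz => ?_, by
      rw [hardyENorm_smul]; exact ENNReal.mul_lt_top enorm_lt_top hf.2⟩
    rw [zeroExt_smul]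
    exact (hf.1 z hz).const_smul c

/-- The Hardy space `H²(ℓ₂(𝔭^{1/k}) ∩ B_{ℓ_∞(𝔭^{1/k})})` of holomorphic functions. -/
def HardyH2 (k : ℕ+) : Type := hardyFunctions k

namespace HardyH2

instance (k : ℕ+) : AddCommGroup (HardyH2 k) := inferInstanceAs (AddCommGroup (hardyFunctions k))
instance (k : ℕ+) : Module ℂ (HardyH2 k) := inferInstanceAs (Module ℂ (hardyFunctions k))

/-- The function underlying an element of the Hardy space. -/
def toFun (k : ℕ+) : HardyH2 k →ₗ[ℂ] (Omega k → ℂ) := (hardyFunctions k).subtype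

instance (k : ℕ+) : Norm (HardyH2 k) := ⟨fun f => (hardyENorm k (toFun k f)).toReal⟩

lemma normCore (k : ℕ+) : NormedSpace.Core ℂ (HardyH2 k) where
  norm_nonneg f := ENNReal.toReal_nonneg
  norm_smul c f := by
    change (hardyENorm k (toFun k (c • f))).toReal = ‖c‖ * (hardyENorm k (toFun k f)).toReal
    rw [map_smul, hardyENorm_smul, ENNReal.toReal_mul, toReal_enorm]
  norm_triangle f g := by
    change (hardyENorm k (toFun k (f + g))).toReal ≤
      (hardyENorm k (toFun k f)).toReal + (hardyENorm k (toFun k g)).toReal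
    have hf : hardyENorm k (toFun k f) < ∞ := f.2.2
    have hg : hardyENorm k (toFun k g) < ∞ := g.2.2
    rw [map_add, ← ENNReal.toReal_add hf.ne hg.ne]
    exact ENNReal.toReal_mono (ENNReal.add_lt_top.2 ⟨hf, hg⟩).ne
      (hardyENorm_add_le f.2.1 g.2.1)
  norm_eq_zero_iff f := by
    change (hardyENorm k (toFun k f)).toReal = 0 ↔ f = 0
    constructor
    · intro h
      exact Subtype.ext (eq_zero_of_hardyENorm_eq_zero f.2.1
        (((ENNReal.toReal_eq_zero_iff _).1 h).resolve_right f.2.2.ne))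
    · rintro rfl
      rw [map_zero, hardyENorm_zero, ENNReal.toReal_zero]

instance (k : ℕ+) : NormedAddCommGroup (HardyH2 k) := NormedAddCommGroup.ofCore (normCore k)
instance (k : ℕ+) : NormedSpace ℂ (HardyH2 k) := NormedSpace.ofCore (normCore k)

end HardyH2

/-- `c` is the family of monomial coefficients of `f`: for every `N` the restriction of `f` to
`Omega k ∩ ℂ^N` has the power series expansion `f(z) = ∑_α c_α z^α`. (At a point of `ℂ^N` the terms
of multi-indices that involve further variables are zero.) -/
def HasMonomialCoeffs {k : ℕ+} (f : Omega k → ℂ) (c : (ℕ →₀ ℕ) → ℂ) : Prop :=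
  ∀ (N : ℕ) (z : Omega k), (∀ j, N ≤ j → (z : ℕ → ℂ) j = 0) →
    HasSum (fun α : ℕ →₀ ℕ => c α * α.prod fun j m => (z : ℕ → ℂ) j ^ m) (f z)

/-- The restriction to `Omega k` of a function on the union of all these domains. -/
def restrictOmega (k : ℕ+) : ((⋃ i : ℕ+, Omega i : Set (ℕ → ℂ)) → ℂ) →ₗ[ℂ] (Omega k → ℂ) where
  toFun f := fun z => f ⟨z, Set.mem_iUnion.2 ⟨k, z.2⟩⟩
  map_add' _ _ := rfl
  map_smul' _ _ := rfl

/-- The intersection of the Hardy spaces: the functions on the union of the (increasing) domains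
`Omega k` whose restriction to each `Omega k` belongs to `HardyH2 k`. -/
def hardyInterFunctions : Submodule ℂ ((⋃ i : ℕ+, Omega i : Set (ℕ → ℂ)) → ℂ) :=
  ⨅ k : ℕ+, (hardyFunctions k).comap (restrictOmega k)

/-- The intersection of the Hardy spaces, with the topology of the projective limit. -/
def HardyInter : Type := hardyInterFunctions

namespace HardyInter

instance : AddCommGroup HardyInter := inferInstanceAs (AddCommGroup hardyInterFunctions)
instance : Module ℂ HardyInter := inferInstanceAs (Module ℂ hardyInterFunctions)

/-- The canonical map of the intersection into the `k`-th Hardy space. -/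
def toHardy (k : ℕ+) : HardyInter →ₗ[ℂ] HardyH2 k :=
  (restrictOmega k).restrict (p := hardyInterFunctions) (q := hardyFunctions k) fun _ hf =>
    (Submodule.mem_iInf _).1 hf k

/-- The topology of the projective limit: the coarsest one for which the maps `toHardy k` are
continuous. -/
instance : TopologicalSpace HardyInter :=
  ⨅ k : ℕ+, TopologicalSpace.induced (toHardy k) inferInstance

end HardyInter

end

/-!
Bohr's correspondence `n = 𝔭^α ↔ α` turns a Dirichlet series into a power series in infinitely many
variables.  On a torus of radii `r` inside a finite-dimensional polydisc, the Fourier coefficients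
of a holomorphic function with a negative index vanish and the others scale like `r^α`; this gives
the power series of `f` on every section `Ω_k ∩ ℂ^N`.  By Parseval's formula on these tori,
`‖f‖² = ∑ |c_α(f)|² 𝔭^{-2α/k}`, which is the norm of the Dirichlet series with `a_{𝔭^α} = c_α(f)`
in `𝓗²ₖ`.  Conversely, with `ρ = sup |z_j 𝔭_j^{1/k}| < 1` the Euler product estimate
`∑ |z^α 𝔭^{α/k}|² = ∏ (1 - |z_j 𝔭_j^{1/k}|²)⁻¹ ≤ exp (‖z‖² / (1 - ρ²))` and the Cauchy–Schwarz
inequality show that square-summable coefficients `c_α 𝔭^{-α/k}` define a series that converges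
locally uniformly on `Ω_k`, hence a holomorphic function there.
-/

section UniformLimits

variable {ι E G : Type*} [NormedAddCommGroup E] [NormedSpace ℂ E] [NormedAddCommGroup G]
  [NormedSpace ℂ G] {l : Filter ι} {F : ι → E → G}

lemma norm_fderiv_le_of_norm_le_on_ball {f : E → G} {c : E} {r M : ℝ} (hr : 0 < r)
    (hf : DifferentiableOn ℂ f (Metric.ball c r)) (hM : ∀ z ∈ Metric.ball c r, ‖f z‖ ≤ M) :
    ‖fderiv ℂ f c‖ ≤ (M + M) / r := by
  refine Complex.norm_fderiv_le_div_of_mapsTo_ball hf (fun z hz => ?_) hr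
  rw [mem_closedBall_iff_norm]
  exact (norm_sub_le _ _).trans (add_le_add (hM z hz) (hM c (Metric.mem_ball_self hr)))

lemma uniformCauchySeqOn_fderiv {s U : Set E} {r : ℝ} (hr : 0 < r)
    (hsU : ∀ x ∈ s, Metric.ball x r ⊆ U) (hF : ∀ n, DifferentiableOn ℂ (F n) U)
    (h : UniformCauchySeqOn F l U) : UniformCauchySeqOn (fun n => fderiv ℂ (F n)) l s := by
  intro u hu
  obtain ⟨ε, hε, hεu⟩ := Metric.mem_uniformity_dist.1 hu
  filter_upwards [h _ (Metric.dist_mem_uniformity (show 0 < ε * r / 3 by positivity))]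
    with n hn x hx
  have hd : ∀ i, DifferentiableAt ℂ (F i) x := fun i =>
    (hF i).differentiableAt (mem_of_superset (Metric.ball_mem_nhds x hr) (hsU x hx))
  have hbound : ‖fderiv ℂ (F n.1 - F n.2) x‖ ≤ (ε * r / 3 + ε * r / 3) / r := by
    refine norm_fderiv_le_of_norm_le_on_ball hr (((hF n.1).sub (hF n.2)).mono (hsU x hx))
      fun z hz => ?_
    rw [Pi.sub_apply, ← dist_eq_norm]
    exact (hn z (hsU x hx hz)).le
  apply hεu
  rw [dist_eq_norm, ← fderiv_sub (hd _) (hd _)]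
  refine hbound.trans_lt ?_
  rw [div_lt_iff₀ hr]
  linarith [mul_pos hε hr]

theorem differentiableAt_of_tendstoUniformlyOn [CompleteSpace G] [l.NeBot] {g : E → G} {c : E}
    {V : Set E} (hV : V ∈ 𝓝 c) (hF : ∀ n, DifferentiableOn ℂ (F n) V)
    (h : TendstoUniformlyOn F g l V) : DifferentiableAt ℂ g c := by
  obtain ⟨R, hR, hRV⟩ := Metric.mem_nhds_iff.1 hV
  set s := Metric.ball c (R / 2)
  have hsV : ∀ x ∈ s, Metric.ball x (R / 2) ⊆ V := fun x hx =>
    (Metric.ball_subset_ball' (by linarith [Metric.mem_ball.1 hx])).trans hRV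
  have hs : ∀ x ∈ s, V ∈ 𝓝 x := fun x hx =>
    mem_of_superset (Metric.ball_mem_nhds x (half_pos hR)) (hsV x hx)
  have hcauchy : UniformCauchySeqOn (fun n => fderiv ℂ (F n)) l s :=
    uniformCauchySeqOn_fderiv (half_pos hR) hsV hF h.uniformCauchySeqOn
  have hlim : ∀ x ∈ s, ∃ y, Tendsto (fun n => fderiv ℂ (F n) x) l (𝓝 y) := fun x hx =>
    CompleteSpace.complete (hcauchy.cauchy_map hx)
  choose! g' hg' using hlim
  exact (hasFDerivAt_of_tendstoUniformlyOn Metric.isOpen_ball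
    (hcauchy.tendstoUniformlyOn_of_tendsto hg')
    (fun n x hx => ((hF n).differentiableAt (hs x hx)).hasFDerivAt)
    (fun x hx => h.tendsto_at (mem_of_mem_nhds (hs x hx)))
    (Metric.mem_ball_self (half_pos hR))).differentiableAt

end UniformLimits

section MultiIndexSums

variable {ι : Type*}

lemma sum_finsupp_prod {R M : Type*} [CommSemiring R] [Zero M] (s : Finset ι) (t : ι → Finset M)
    {f : ι → M → R} (hf : ∀ i, f i 0 = 1) :
    ∑ α ∈ s.finsupp t, α.prod f = ∏ i ∈ s, ∑ m ∈ t i, f i m := by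
  classical
  rw [Finset.prod_sum, Finset.finsupp, Finset.sum_map]
  refine Finset.sum_congr rfl fun p _ => ?_
  rw [Function.Embedding.coeFn_mk, Finsupp.prod_of_support_subset _
    (Finsupp.support_indicator_subset s p) _ fun i _ => hf i, ← Finset.prod_attach]
  exact Finset.prod_congr rfl fun i _ => by rw [Finsupp.indicator_of_mem i.2]

lemma sum_pow_le_exp {x ρ : ℝ} (h0 : 0 ≤ x) (hx : x ≤ ρ) (hρ : ρ < 1) (T : Finset ℕ) :
    ∑ m ∈ T, x ^ m ≤ Real.exp (x / (1 - ρ)) := by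
  have hx1 : x < 1 := hx.trans_lt hρ
  calc ∑ m ∈ T, x ^ m
      ≤ (1 - x)⁻¹ :=
        sum_le_hasSum T (fun m _ => pow_nonneg h0 m) (hasSum_geometric_of_lt_one h0 hx1)
    _ = x / (1 - x) + 1 := by
        have : 1 - x ≠ 0 := by linarith
        field_simp
        ring
    _ ≤ x / (1 - ρ) + 1 := by gcongr
    _ ≤ Real.exp (x / (1 - ρ)) := Real.add_one_le_exp _

variable {x : ι → ℝ} {ρ : ℝ}

theorem sum_prod_pow_le_exp_tsum (h0 : ∀ j, 0 ≤ x j) (hx : ∀ j, x j ≤ ρ) (hρ : ρ < 1)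
    (hs : Summable x) (S : Finset (ι →₀ ℕ)) :
    ∑ α ∈ S, (α.prod fun j m => x j ^ m) ≤ Real.exp ((∑' j, x j) / (1 - ρ)) := by
  classical
  set s := S.biUnion Finsupp.support
  set t : ι → Finset ℕ := fun j => S.image fun α => α j
  have hS : S ⊆ s.finsupp t := fun α hα => Finset.mem_finsupp_iff.2
    ⟨Finset.subset_biUnion_of_mem _ hα, fun j _ => Finset.mem_image_of_mem _ hα⟩
  calc ∑ α ∈ S, (α.prod fun j m => x j ^ m)
      ≤ ∑ α ∈ s.finsupp t, (α.prod fun j m => x j ^ m) :=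
        Finset.sum_le_sum_of_subset_of_nonneg hS fun α _ _ =>
          Finset.prod_nonneg fun j _ => pow_nonneg (h0 j) _
    _ = ∏ j ∈ s, ∑ m ∈ t j, x j ^ m := sum_finsupp_prod s t fun j => pow_zero (x j)
    _ ≤ ∏ j ∈ s, Real.exp (x j / (1 - ρ)) :=
        Finset.prod_le_prod (fun j _ => Finset.sum_nonneg fun m _ => pow_nonneg (h0 j) m)
          fun j _ => sum_pow_le_exp (h0 j) (hx j) hρ _
    _ = Real.exp ((∑ j ∈ s, x j) / (1 - ρ)) := by rw [← Real.exp_sum, ← Finset.sum_div]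
    _ ≤ Real.exp ((∑' j, x j) / (1 - ρ)) := by
        gcongr
        exact hs.sum_le_tsum s fun j _ => h0 j

lemma summable_prod_pow [Finite ι] (h0 : ∀ j, 0 ≤ x j) (h1 : ∀ j, x j < 1) :
    Summable fun α : ι →₀ ℕ => α.prod fun j m => x j ^ m := by
  obtain ⟨ρ, hρ, hxρ⟩ : ∃ ρ < 1, ∀ j, x j ≤ ρ := by
    rcases isEmpty_or_nonempty ι with h | h
    · exact ⟨0, zero_lt_one, h.elim⟩
    · obtain ⟨i, hi⟩ := Finite.exists_max x
      exact ⟨x i, h1 i, hi⟩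
  exact summable_of_sum_le (fun α => Finset.prod_nonneg fun j _ => pow_nonneg (h0 j) _)
    (sum_prod_pow_le_exp_tsum h0 hxρ hρ (Summable.of_finite))

end MultiIndexSums

section OrthonormalSeries

variable {𝕜 ι H : Type*} [RCLike 𝕜] [NormedAddCommGroup H] [InnerProductSpace 𝕜 H] {v : ι → H}
  {a : ι → 𝕜} {x : H}

lemma inner_left_eq_coeff_of_hasSum (hv : Orthonormal 𝕜 v) (hx : HasSum (fun i => a i • v i) x)
    (i : ι) : inner 𝕜 (v i) x = a i := by
  classical
  refine ((innerSL 𝕜 (v i)).hasSum hx).unique ?_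
  convert hasSum_ite_eq i (a i) using 2 with j
  simp only [map_smul, innerSL_apply_apply, orthonormal_iff_ite.1 hv, smul_eq_mul]
  rcases eq_or_ne j i with rfl | hj
  · simp
  · simp [hj, hj.symm]

lemma hasSum_norm_sq_coeff (hv : Orthonormal 𝕜 v) (hx : HasSum (fun i => a i • v i) x) :
    HasSum (fun i => ‖a i‖ ^ 2) (‖x‖ ^ 2) := by
  have hinner : HasSum (fun i => inner 𝕜 x (a i • v i)) (inner 𝕜 x x) := (innerSL 𝕜 x).hasSum hx
  rw [← RCLike.hasSum_ofReal (𝕜 := 𝕜)]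
  convert hinner using 1
  · ext i
    rw [inner_smul_right, ← inner_conj_symm, inner_left_eq_coeff_of_hasSum hv hx, RCLike.mul_conj]
    norm_cast
  · rw [inner_self_eq_norm_sq_to_K]
    norm_cast

variable {X : Type*} [TopologicalSpace X] [CompactSpace X] {e : ι → C(X, 𝕜)} {F : X → 𝕜}

lemma exists_continuousMap_hasSum (ha : Summable fun i => ‖a i • e i‖)
    (hF : ∀ t, HasSum (fun i => a i * e i t) (F t)) :
    ∃ G : C(X, 𝕜), ⇑G = F ∧ HasSum (fun i => a i • e i) G :=
  ⟨_, funext fun t => ((ContinuousMap.evalCLM 𝕜 t).hasSum ha.of_norm.hasSum).unique (hF t),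
    ha.of_norm.hasSum⟩

variable [MeasurableSpace X] [BorelSpace X] {μ : Measure X} [IsFiniteMeasure μ]

lemma integral_star_mul_eq_coeff (he : Orthonormal 𝕜 fun i => ContinuousMap.toLp 2 μ 𝕜 (e i))
    (ha : Summable fun i => ‖a i • e i‖) (hF : ∀ t, HasSum (fun i => a i * e i t) (F t)) (i : ι) :
    ∫ t, star (e i t) * F t ∂μ = a i := by
  obtain ⟨G, rfl, hG⟩ := exists_continuousMap_hasSum ha hF
  have hG' := (ContinuousMap.toLp 2 μ 𝕜).hasSum hG
  simp only [map_smul] at hG'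
  rw [← inner_left_eq_coeff_of_hasSum he hG' i, ContinuousMap.inner_toLp]
  exact integral_congr_ae (.of_forall fun t => mul_comm _ _)

lemma eLpNorm_sq_eq_tsum_coeff (he : Orthonormal 𝕜 fun i => ContinuousMap.toLp 2 μ 𝕜 (e i))
    (ha : Summable fun i => ‖a i • e i‖) (hF : ∀ t, HasSum (fun i => a i * e i t) (F t)) :
    eLpNorm F 2 μ ^ 2 = ∑' i, ‖a i‖ₑ ^ 2 := by
  obtain ⟨G, rfl, hG⟩ := exists_continuousMap_hasSum ha hF
  have hG' := (ContinuousMap.toLp 2 μ 𝕜).hasSum hG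
  simp only [map_smul] at hG'
  have hnorm := hasSum_norm_sq_coeff he hG'
  rw [← eLpNorm_congr_ae (ContinuousMap.coeFn_toLp (p := 2) (𝕜 := 𝕜) μ G), ← Lp.enorm_def,
    ← ofReal_norm, ← ENNReal.ofReal_pow (norm_nonneg _), ← hnorm.tsum_eq,
    ENNReal.ofReal_tsum_of_nonneg (fun i => by positivity) hnorm.summable]
  exact tsum_congr fun i => by rw [ENNReal.ofReal_pow (norm_nonneg _), ofReal_norm]

end OrthonormalSeries

section Circle

lemma fourierCoeff_of_hasSum {T : ℝ} [Fact (0 < T)] {a : ℤ → ℂ} {F : AddCircle T → ℂ}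
    (ha : Summable fun n => ‖a n‖) (hF : ∀ x, HasSum (fun n => a n * fourier n x) (F x)) (n : ℤ) :
    fourierCoeff F n = a n := by
  have hsum : Summable fun n => ‖a n • (fourier n : C(AddCircle T, ℂ))‖ := by
    simpa only [norm_smul, fourier_norm, mul_one] using ha
  rw [← integral_star_mul_eq_coeff orthonormal_fourier hsum hF n]
  simp only [fourierCoeff, fourier_neg, smul_eq_mul]
  rfl

lemma coe_toCircle_pow (x : UnitAddCircle) (n : ℕ) :
    (x.toCircle : ℂ) ^ n = fourier (n : ℤ) x := by
  rw [fourier_apply, AddCircle.toCircle_zsmul, zpow_natCast, Circle.coe_pow]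

variable {h : ℂ → ℂ} {R s : ℝ}

lemma fourierCoeff_circle (hh : DifferentiableOn ℂ h (Metric.ball 0 R)) (hs : 0 ≤ s) (hsR : s < R)
    (m : ℤ) : fourierCoeff (fun x : UnitAddCircle => h (s * x.toCircle)) m =
      if 0 ≤ m then (m.toNat.factorial : ℂ)⁻¹ * iteratedDeriv m.toNat h 0 * s ^ m.toNat else 0 := by
  set a : ℤ → ℂ := fun m =>
    if 0 ≤ m then (m.toNat.factorial : ℂ)⁻¹ * iteratedDeriv m.toNat h 0 * s ^ m.toNat else 0
  have ha : ∀ x, HasSum (fun m => a m * fourier m x) (h (s * (x : UnitAddCircle).toCircle)) := by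
    intro x
    have hmem : (s : ℂ) * x.toCircle ∈ Metric.ball (0 : ℂ) R := by
      simpa [abs_of_nonneg hs, Circle.norm_coe] using hsR
    rw [← (Nat.cast_injective (R := ℤ)).hasSum_iff fun m hm => ?_]
    · convert! Complex.hasSum_taylorSeries_on_ball hh hmem using 2 with n
      simp only [a, Function.comp_apply, Int.natCast_nonneg, if_true, Int.toNat_natCast, sub_zero,
        mul_pow, coe_toCircle_pow, smul_eq_mul]
      ring
    · have : ¬ 0 ≤ m := fun h0 => hm ⟨m.toNat, Int.toNat_of_nonneg h0⟩
      simp [a, this]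
  refine fourierCoeff_of_hasSum ?_ ha m
  simpa using (ha 0).summable.norm

lemma fourierCoeff_circle_of_neg (hh : DifferentiableOn ℂ h (Metric.ball 0 R)) (hs : 0 ≤ s)
    (hsR : s < R) {m : ℤ} (hm : m < 0) :
    fourierCoeff (fun x : UnitAddCircle => h (s * x.toCircle)) m = 0 := by
  rw [fourierCoeff_circle hh hs hsR, if_neg hm.not_ge]

lemma fourierCoeff_circle_mul_pow {r : ℝ} (hh : DifferentiableOn ℂ h (Metric.ball 0 R))
    (hs : 0 ≤ s) (hsR : s < R) (hr : 0 ≤ r) (hrR : r < R) (m : ℕ) :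
    fourierCoeff (fun x : UnitAddCircle => h (s * x.toCircle)) m * r ^ m =
      fourierCoeff (fun x : UnitAddCircle => h (r * x.toCircle)) m * s ^ m := by
  rw [fourierCoeff_circle hh hs hsR, fourierCoeff_circle hh hr hrR]
  simp only [Int.natCast_nonneg, if_true, Int.toNat_natCast]
  ring

end Circle

section Polydisc

variable {d : Type*} {R r s : d → ℝ} {F : (d → ℂ) → ℂ}

/-- The open polydisc with centre `0` and radii `R`. -/
def polydisc (R : d → ℝ) : Set (d → ℂ) := {z | ∀ j, ‖z j‖ < R j}

/-- The point with moduli `r` and angles `t`. -/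
noncomputable def torusPoint (r : d → ℝ) (t : UnitAddTorus d) : d → ℂ :=
  fun j => r j * (t j).toCircle

lemma torusPoint_mem_polydisc (hr : ∀ j, r j ∈ Set.Ico 0 (R j)) (t : UnitAddTorus d) :
    torusPoint r t ∈ polydisc R := fun j => by
  simpa [torusPoint, abs_of_nonneg (hr j).1, Circle.norm_coe] using (hr j).2

lemma continuous_torusPoint (r : d → ℝ) : Continuous (torusPoint r) :=
  continuous_pi fun j => continuous_const.mul
    (continuous_subtype_val.comp (AddCircle.continuous_toCircle.comp (continuous_apply j)))

lemma continuous_comp_torusPoint (hF : ContinuousOn F (polydisc R))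
    (hr : ∀ j, r j ∈ Set.Ico 0 (R j)) : Continuous fun t => F (torusPoint r t) :=
  hF.comp_continuous (continuous_torusPoint r) (torusPoint_mem_polydisc hr)

lemma exists_torusPoint_eq (z : d → ℂ) : ∃ t, torusPoint (fun j => ‖z j‖) t = z := by
  have hpolar : ∀ j, ∃ t : UnitAddCircle, (‖z j‖ : ℂ) * t.toCircle = z j := fun j => by
    obtain ⟨t, ht⟩ := (AddCircle.homeomorphCircle (T := 1) one_ne_zero).surjective
      (Circle.exp (z j).arg)
    refine ⟨t, ?_⟩
    rw [← AddCircle.homeomorphCircle_apply one_ne_zero, ht, Circle.coe_exp,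
      Complex.norm_mul_exp_arg_mul_I]
  choose t ht using hpolar
  exact ⟨t, funext ht⟩

lemma torusPoint_update_add_single [DecidableEq d] (r : d → ℝ) (j : d) (a : ℝ) (t : UnitAddTorus d)
    (x : UnitAddCircle) :
    torusPoint (Function.update r j a) (t + Pi.single j x) =
      Function.update (torusPoint r t) j (a * x.toCircle * (t j).toCircle) := by
  ext i
  rcases eq_or_ne i j with rfl | h
  · simp only [torusPoint, Function.update_self, Pi.add_apply, Pi.single_eq_same,
      AddCircle.toCircle_add, Circle.coe_mul]
    ring
  · simp [torusPoint, h]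

lemma update_mem_Ico [DecidableEq d] (hr : ∀ i, r i ∈ Set.Ico 0 (R i)) {j : d} {a : ℝ}
    (ha : a ∈ Set.Ico 0 (R j)) (i : d) : Function.update r j a i ∈ Set.Ico 0 (R i) := by
  rcases eq_or_ne i j with rfl | h
  · rwa [Function.update_self]
  · rw [Function.update_of_ne h]
    exact hr i

lemma natCast_comp_injective :
    Function.Injective fun (α : d →₀ ℕ) (j : d) => (α j : ℤ) :=
  Nat.cast_injective.comp_left.comp DFunLike.coe_injective

lemma exists_neg_of_notMem_range [Finite d] {n : d → ℤ}
    (hn : n ∉ Set.range fun (α : d →₀ ℕ) (j : d) => (α j : ℤ)) : ∃ j, n j < 0 := by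
  by_contra! h
  exact hn ⟨Finsupp.equivFunOnFinite.symm fun j => (n j).toNat,
    funext fun j => Int.toNat_of_nonneg (h j)⟩

lemma differentiableOn_slice [Finite d] [DecidableEq d] (hF : DifferentiableOn ℂ F (polydisc R))
    {z : d → ℂ} (hz : z ∈ polydisc R) (j : d) (u : Circle) :
    DifferentiableOn ℂ (fun ζ : ℂ => F (Function.update z j (ζ * u))) (Metric.ball 0 (R j)) := by
  cases nonempty_fintype d
  refine hF.comp (f := fun ζ : ℂ => Function.update z j (ζ * u))
    (Differentiable.differentiableOn (differentiable_pi.2 fun i => ?_)) fun ζ hζ i => ?_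
  · rcases eq_or_ne i j with rfl | h
    · simp only [Function.update_self]
      fun_prop
    · simp [h]
  · rcases eq_or_ne i j with rfl | h
    · simpa [Circle.norm_coe] using hζ
    · simpa [h] using hz i

section Torus

variable [Fintype d]

/-- The normalized Haar measure of the torus `𝕋^d`. -/
noncomputable abbrev torusMeasure (d : Type*) [Fintype d] : Measure (UnitAddTorus d) :=
  Measure.pi fun _ => AddCircle.haarAddCircle

/-- The monomial `t ↦ t^α` as a function on the torus `𝕋^d`. -/
noncomputable def torusMonomial (α : d →₀ ℕ) : C(UnitAddTorus d, ℂ) :=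
  UnitAddTorus.mFourier fun j => (α j : ℤ)

lemma norm_torusMonomial (α : d →₀ ℕ) : ‖torusMonomial α‖ = 1 := UnitAddTorus.mFourier_norm

lemma orthonormal_torusMonomial : Orthonormal ℂ fun α : d →₀ ℕ =>
    ContinuousMap.toLp 2 (torusMeasure d) ℂ (torusMonomial α) :=
  UnitAddTorus.orthonormal_mFourier.comp _ natCast_comp_injective

/-- The Fourier coefficient of the restriction of `F` to the torus with radii `r`. -/
noncomputable def torusCoeff (F : (d → ℂ) → ℂ) (n : d → ℤ) (r : d → ℝ) : ℂ :=
  UnitAddTorus.mFourierCoeff (fun t => F (torusPoint r t)) n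

lemma prod_torusPoint_pow (r : d → ℝ) (t : UnitAddTorus d) (α : d →₀ ℕ) :
    (α.prod fun j m => torusPoint r t j ^ m) =
      (α.prod fun j m => (r j : ℂ) ^ m) * torusMonomial α t := by
  simp only [torusPoint, mul_pow, coe_toCircle_pow, Finsupp.prod_mul]
  exact congrArg _ (Finsupp.prod_fintype _ _ fun j => by simp)

lemma norm_torusCoeff_le {n : d → ℤ} {M : ℝ} (hM : ∀ t, ‖F (torusPoint r t)‖ ≤ M) :
    ‖torusCoeff F n r‖ ≤ M := by
  have hbound : ∀ t, ‖UnitAddTorus.mFourier (-n) t • F (torusPoint r t)‖ ≤ M := fun t =>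
    calc ‖UnitAddTorus.mFourier (-n) t • F (torusPoint r t)‖
        ≤ ‖UnitAddTorus.mFourier (-n)‖ * ‖F (torusPoint r t)‖ := by
          rw [norm_smul]
          gcongr
          exact ContinuousMap.norm_coe_le_norm _ t
      _ ≤ M := by rw [UnitAddTorus.mFourier_norm, one_mul]; exact hM t
  change ‖∫ t, UnitAddTorus.mFourier (-n) t • F (torusPoint r t) ∂torusMeasure d‖ ≤ M
  simpa using norm_integral_le_of_norm_le_const (μ := torusMeasure d) (.of_forall hbound)

section OneVariable

variable [DecidableEq d]

lemma integral_torus_eq_integral_average {E : Type*} [NormedAddCommGroup E] [NormedSpace ℝ E]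
    [CompleteSpace E] {G : UnitAddTorus d → E} (hG : Continuous G) (j : d) :
    ∫ t, G t ∂torusMeasure d =
      ∫ t, ∫ x, G (t + Pi.single j x) ∂AddCircle.haarAddCircle ∂torusMeasure d := by
  have hc : Continuous fun p : UnitAddTorus d × UnitAddCircle => G (p.1 + Pi.single j p.2) :=
    hG.comp (continuous_fst.add ((continuous_single j).comp continuous_snd))
  rw [integral_integral_swap
    (hc.integrable_of_hasCompactSupport (HasCompactSupport.of_compactSpace _))]
  simp only [integral_add_right_eq_self, integral_const, probReal_univ, one_smul]

lemma mFourier_add_single (n : d → ℤ) (j : d) (t : UnitAddTorus d) (x : UnitAddCircle) :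
    UnitAddTorus.mFourier n (t + Pi.single j x) = UnitAddTorus.mFourier n t * fourier (n j) x := by
  have hfactor : ∀ i, fourier (n i) ((t + Pi.single j x : UnitAddTorus d) i) =
      fourier (n i) (t i) * (if i = j then fourier (n j) x else 1) := fun i => by
    rcases eq_or_ne i j with rfl | h
    · simp [fourier_apply, AddCircle.toCircle_add]
    · simp [h]
  simp only [UnitAddTorus.mFourier, ContinuousMap.coe_mk, hfactor, Finset.prod_mul_distrib,
    Finset.prod_ite_eq', Finset.mem_univ, if_true]

lemma torusCoeff_update_eq_integral (hF : ContinuousOn F (polydisc R)) (n : d → ℤ)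
    (hr : ∀ i, r i ∈ Set.Ico 0 (R i)) {j : d} {a : ℝ} (ha : a ∈ Set.Ico 0 (R j)) :
    torusCoeff F n (Function.update r j a) = ∫ t, UnitAddTorus.mFourier (-n) t *
      fourierCoeff (fun x : UnitAddCircle =>
        F (Function.update (torusPoint r t) j (a * x.toCircle * (t j).toCircle))) (n j)
      ∂torusMeasure d := by
  have hcont : Continuous fun t => UnitAddTorus.mFourier (-n) t •
      F (torusPoint (Function.update r j a) t) :=
    (UnitAddTorus.mFourier (-n)).continuous.smul
      (continuous_comp_torusPoint hF (update_mem_Ico hr ha))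
  -- Rotating the `j`-th coordinate reduces the coefficient on the torus to one on a circle.
  refine (integral_torus_eq_integral_average hcont j).trans (integral_congr_ae (.of_forall ?_))
  intro t
  simp only [mFourier_add_single, torusPoint_update_add_single, fourierCoeff, smul_eq_mul,
    Pi.neg_apply, mul_assoc, integral_const_mul]

lemma torusCoeff_update_mul_pow (hF : DifferentiableOn ℂ F (polydisc R)) (α : d →₀ ℕ)
    (hr : ∀ i, r i ∈ Set.Ico 0 (R i)) {j : d} {a : ℝ} (ha : a ∈ Set.Ico 0 (R j)) :
    torusCoeff F (fun i => α i) (Function.update r j a) * r j ^ α j =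
      torusCoeff F (fun i => α i) r * a ^ α j := by
  conv_rhs => rw [← Function.update_eq_self j r]
  rw [torusCoeff_update_eq_integral hF.continuousOn _ hr ha,
    torusCoeff_update_eq_integral hF.continuousOn _ hr (hr j), ← integral_mul_const,
    ← integral_mul_const]
  refine integral_congr_ae (.of_forall fun t => ?_)
  simp only [mul_assoc (UnitAddTorus.mFourier _ t)]
  rw [fourierCoeff_circle_mul_pow
    (differentiableOn_slice hF (torusPoint_mem_polydisc hr t) j (t j).toCircle)
    ha.1 ha.2 (hr j).1 (hr j).2]

end OneVariable

lemma torusCoeff_eq_zero (hF : DifferentiableOn ℂ F (polydisc R))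
    (hr : ∀ i, r i ∈ Set.Ico 0 (R i)) {n : d → ℤ} {j : d} (hn : n j < 0) :
    torusCoeff F n r = 0 := by
  classical
  rw [← Function.update_eq_self j r, torusCoeff_update_eq_integral hF.continuousOn n hr (hr j)]
  exact integral_eq_zero_of_ae (.of_forall fun t => mul_eq_zero_of_right _
    (fourierCoeff_circle_of_neg
      (differentiableOn_slice hF (torusPoint_mem_polydisc hr t) j (t j).toCircle)
      (hr j).1 (hr j).2 hn))

lemma torusCoeff_mul_prod_pow (hF : DifferentiableOn ℂ F (polydisc R)) (α : d →₀ ℕ)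
    (hr : ∀ j, r j ∈ Set.Ico 0 (R j)) (hs : ∀ j, s j ∈ Set.Ico 0 (R j)) :
    torusCoeff F (fun j => α j) s * (α.prod fun j m => (r j : ℂ) ^ m) =
      torusCoeff F (fun j => α j) r * (α.prod fun j m => (s j : ℂ) ^ m) := by
  classical
  suffices h : ∀ T : Finset d,
      torusCoeff F (fun j => α j) (T.piecewise s r) * ∏ j ∈ T, (r j : ℂ) ^ α j =
        torusCoeff F (fun j => α j) r * ∏ j ∈ T, (s j : ℂ) ^ α j by
    simpa [Finsupp.prod_fintype] using h Finset.univ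
  intro T
  induction T using Finset.induction_on with
  | empty => simp
  | insert j T hj ih =>
    have hmem : ∀ i, T.piecewise s r i ∈ Set.Ico 0 (R i) := fun i =>
      T.piecewise_cases s r (· ∈ Set.Ico 0 (R i)) (hs i) (hr i)
    have hupdate := torusCoeff_update_mul_pow hF α hmem (hs j)
    rw [Finset.piecewise_eq_of_notMem _ _ _ hj] at hupdate
    rw [Finset.piecewise_insert, Finset.prod_insert hj, Finset.prod_insert hj, ← mul_assoc,
      hupdate, mul_right_comm, ih]
    ring

lemma summable_torusCoeff (hF : DifferentiableOn ℂ F (polydisc R))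
    (hs : ∀ j, s j ∈ Set.Ico 0 (R j)) : Summable fun n : d → ℤ => torusCoeff F n s := by
  -- Comparison with a larger torus, of radii `r`, gives a geometric majorant.
  choose r hsr hrR using fun j => exists_between (hs j).2
  have hr0 : ∀ j, 0 < r j := fun j => (hs j).1.trans_lt (hsr j)
  have hr : ∀ j, r j ∈ Set.Ico 0 (R j) := fun j => ⟨(hr0 j).le, hrR j⟩
  obtain ⟨M, hM⟩ : ∃ M, ∀ t, ‖F (torusPoint r t)‖ ≤ M := by
    obtain ⟨M, hM⟩ := (isCompact_range
      (continuous_comp_torusPoint hF.continuousOn hr)).isBounded.exists_norm_le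
    exact ⟨M, fun t => hM _ ⟨t, rfl⟩⟩
  have hscale : ∀ α : d →₀ ℕ, torusCoeff F (fun j => α j) s =
      torusCoeff F (fun j => α j) r * ((α.prod fun j m => (s j / r j) ^ m : ℝ) : ℂ) := fun α => by
    have hprod : (α.prod fun j m => (r j : ℂ) ^ m) ≠ 0 :=
      Finset.prod_ne_zero_iff.2 fun j _ => pow_ne_zero _ (by exact_mod_cast (hr0 j).ne')
    rw [eq_div_of_mul_eq hprod (torusCoeff_mul_prod_pow hF α hr hs)]
    simp [Finsupp.prod, div_pow, Finset.prod_div_distrib, mul_div_assoc]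
  have hratio : ∀ j, 0 ≤ s j / r j := fun j => div_nonneg (hs j).1 (hr0 j).le
  rw [← natCast_comp_injective.summable_iff fun n hn =>
    (exists_neg_of_notMem_range hn).elim fun j hj => torusCoeff_eq_zero hF hs hj]
  refine .of_norm_bounded ((summable_prod_pow hratio fun j =>
    (div_lt_one (hr0 j)).2 (hsr j)).mul_left M) fun α => ?_
  have hprod : 0 ≤ α.prod fun j m => (s j / r j) ^ m :=
    Finset.prod_nonneg fun j _ => pow_nonneg (hratio j) _
  rw [Function.comp_apply, hscale, norm_mul, Complex.norm_real, Real.norm_of_nonneg hprod]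
  exact mul_le_mul_of_nonneg_right (norm_torusCoeff_le hM) hprod

lemma hasSum_torusCoeff (hF : DifferentiableOn ℂ F (polydisc R))
    (hs : ∀ j, s j ∈ Set.Ico 0 (R j)) (t : UnitAddTorus d) :
    HasSum (fun α : d →₀ ℕ => torusCoeff F (fun j => α j) s * torusMonomial α t)
      (F (torusPoint s t)) := by
  have hfourier := UnitAddTorus.hasSum_mFourier_series_apply_of_summable
    (f := ⟨_, continuous_comp_torusPoint hF.continuousOn hs⟩) (summable_torusCoeff hF hs) t
  rw [← natCast_comp_injective.hasSum_iff fun n hn => ?_] at hfourier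
  · exact hfourier
  · obtain ⟨j, hj⟩ := exists_neg_of_notMem_range hn
    exact mul_eq_zero_of_left (torusCoeff_eq_zero hF hs hj) _

end Torus

theorem exists_hasSum_polydisc [Finite d] (hR : ∀ j, 0 < R j)
    (hF : DifferentiableOn ℂ F (polydisc R)) :
    ∃ c : (d →₀ ℕ) → ℂ, ∀ z ∈ polydisc R,
      HasSum (fun α => c α * α.prod fun j m => z j ^ m) (F z) := by
  cases nonempty_fintype d
  set q : d → ℝ := fun j => R j / 2
  have hq : ∀ j, q j ∈ Set.Ico 0 (R j) := fun j => ⟨(half_pos (hR j)).le, half_lt_self (hR j)⟩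
  refine ⟨fun α => torusCoeff F (fun j => α j) q / α.prod fun j m => (q j : ℂ) ^ m,
    fun z hz => ?_⟩
  obtain ⟨t, ht⟩ := exists_torusPoint_eq z
  have hz' : ∀ j, ‖z j‖ ∈ Set.Ico 0 (R j) := fun j => ⟨norm_nonneg _, hz j⟩
  rw [← ht]
  refine (hasSum_torusCoeff hF hz' t).congr_fun fun α => ?_
  have hprod : (α.prod fun j m => (q j : ℂ) ^ m) ≠ 0 :=
    Finset.prod_ne_zero_iff.2 fun j _ => pow_ne_zero _ (by exact_mod_cast (half_pos (hR j)).ne')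
  rw [prod_torusPoint_pow, ← mul_assoc, div_mul_eq_mul_div,
    ← torusCoeff_mul_prod_pow hF α hq hz', mul_div_cancel_right₀ _ hprod]

end Polydisc

section Coefficients

lemma norm_mul_weight_lt_one_iff {k : ℕ+} {j : ℕ} {z : ℂ} :
    ‖z * weight k j‖ < 1 ↔ ‖z‖ < (weight k j)⁻¹ := by
  rw [norm_mul, Complex.norm_real, Real.norm_of_nonneg (weight_pos k j).le, ← one_div,
    lt_div_iff₀ (weight_pos k j)]

variable {N : ℕ}

/-- The multi-index `(α₁, …, α_N, 0, 0, …)`. -/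
noncomputable def padIndex (α : Fin N →₀ ℕ) : ℕ →₀ ℕ := α.embDomain Fin.valEmbedding

lemma padIndex_injective : Function.Injective (padIndex (N := N)) :=
  Finsupp.embDomain_injective _

lemma mem_range_padIndex_iff {α : ℕ →₀ ℕ} :
    α ∈ Set.range (padIndex (N := N)) ↔ ∀ j, N ≤ j → α j = 0 := by
  have hrange : Set.range (Fin.valEmbedding : Fin N ↪ ℕ) = {j | j < N} :=
    Set.ext fun j => ⟨fun ⟨i, hi⟩ => hi ▸ i.2, fun hj => ⟨⟨j, hj⟩, rfl⟩⟩
  refine (Finsupp.mem_range_embDomain_iff _ _).trans ?_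
  rw [hrange]
  exact forall_congr' fun j => by
    rw [SetLike.mem_coe, Finsupp.mem_support_iff, Set.mem_ofPred_eq, ← not_le, not_imp_not]

lemma exists_mem_range_padIndex (α : ℕ →₀ ℕ) : ∃ N, α ∈ Set.range (padIndex (N := N)) := by
  obtain ⟨N, hN⟩ := α.support.exists_nat_subset_range
  refine ⟨N, mem_range_padIndex_iff.2 fun j hj => Finsupp.notMem_support_iff.1 fun h => ?_⟩
  exact hj.not_gt (Finset.mem_range.1 (hN h))

lemma exists_subset_range_padIndex (S : Finset (ℕ →₀ ℕ)) :
    ∃ N, 1 ≤ N ∧ ∀ α ∈ S, α ∈ Set.range (padIndex (N := N)) := by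
  choose n hn using exists_mem_range_padIndex
  refine ⟨S.sup n + 1, Nat.succ_pos _, fun α hα => mem_range_padIndex_iff.2 fun j hj => ?_⟩
  exact mem_range_padIndex_iff.1 (hn α) j ((Finset.le_sup hα).trans (Nat.le_of_succ_le hj))

lemma prod_padIndex {M : Type*} [CommMonoid M] (α : Fin N →₀ ℕ) (g : ℕ → ℕ → M) :
    (padIndex α).prod g = α.prod fun j m => g j m :=
  Finsupp.prod_embDomain

lemma padZero_apply (w : Fin N → ℂ) (j : Fin N) : padZero N w j = w j := by
  simp [padZero]

lemma padZero_eq_self {z : ℕ → ℂ} (hz : ∀ j, N ≤ j → z j = 0) :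
    padZero N (fun j => z j) = z := by
  ext j
  rcases lt_or_ge j N with hj | hj
  · exact padZero_apply _ ⟨j, hj⟩
  · simp [padZero, hj.not_gt, hz j hj]

lemma hasSum_padIndex_iff {z : ℕ → ℂ} (hz : ∀ j, N ≤ j → z j = 0) {c : (ℕ →₀ ℕ) → ℂ} {v : ℂ} :
    HasSum (fun α : Fin N →₀ ℕ => c (padIndex α) * α.prod fun j m => z j ^ m) v ↔
      HasSum (fun α : ℕ →₀ ℕ => c α * α.prod fun j m => z j ^ m) v := by
  rw [← (padIndex_injective (N := N)).hasSum_iff]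
  · simp only [Function.comp_def, prod_padIndex]
  · intro α hα
    obtain ⟨j, hj, hαj⟩ : ∃ j, N ≤ j ∧ α j ≠ 0 := by
      simpa only [mem_range_padIndex_iff, not_forall, exists_prop] using hα
    rw [Finsupp.prod, Finset.prod_eq_zero (Finsupp.mem_support_iff.2 hαj), mul_zero]
    rw [hz j hj, zero_pow hαj]

variable {k : ℕ+} {f : Omega k → ℂ} {c c' : (ℕ →₀ ℕ) → ℂ} {r : Fin N → ℝ}

/-- `c` are the coefficients of the power series of `f` on the polydisc `Omega k ∩ ℂ^N`; this is
the instance for `N` of `HasMonomialCoeffs f c`. -/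
def HasCoeffsOn (f : Omega k → ℂ) (N : ℕ) (c : (ℕ →₀ ℕ) → ℂ) : Prop :=
  ∀ z : Omega k, (∀ j, N ≤ j → (z : ℕ → ℂ) j = 0) →
    HasSum (fun α : ℕ →₀ ℕ => c α * α.prod fun j m => (z : ℕ → ℂ) j ^ m) (f z)

lemma HasCoeffsOn.mono {M : ℕ} (h : HasCoeffsOn f N c) (hM : M ≤ N) : HasCoeffsOn f M c :=
  fun z hz => h z fun j hj => hz j (hM.trans hj)

lemma HasCoeffsOn.hasSum_padZero (h : HasCoeffsOn f N c) {w : Fin N → ℂ}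
    (hw : padZero N w ∈ Omega k) :
    HasSum (fun α : Fin N →₀ ℕ => c (padIndex α) * α.prod fun j m => w j ^ m)
      (zeroExt f (padZero N w)) := by
  have hz : ∀ j, N ≤ j → padZero N w j = 0 := fun j hj => by simp [padZero, hj]
  have hsum := (hasSum_padIndex_iff hz).2 (h ⟨_, hw⟩ hz)
  simpa only [padZero_apply, ← zeroExt_apply f] using hsum

lemma HasCoeffsOn.hasSum_onTorus (h : HasCoeffsOn f N c)
    (hr : ∀ j, 0 < r j ∧ r j < (weight k j)⁻¹) (t : UnitAddTorus (Fin N)) :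
    HasSum (fun α : Fin N →₀ ℕ => (c (padIndex α) * α.prod fun j m => (r j : ℂ) ^ m) *
      torusMonomial α t) (onTorus f N r t) := by
  simp only [mul_assoc, ← prod_torusPoint_pow]
  exact h.hasSum_padZero (onTorus_mem hr t)

lemma HasCoeffsOn.summable_norm (h : HasCoeffsOn f N c)
    (hr : ∀ j, 0 < r j ∧ r j < (weight k j)⁻¹) :
    Summable fun α : Fin N →₀ ℕ =>
      ‖(c (padIndex α) * α.prod fun j m => (r j : ℂ) ^ m) • torusMonomial α‖ := by
  refine (h.hasSum_onTorus hr 0).summable.norm.congr fun α => ?_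
  have h0 : torusMonomial α 0 = 1 := by simp [torusMonomial, UnitAddTorus.mFourier]
  rw [norm_mul, norm_smul, norm_torusMonomial, h0, norm_one]

lemma HasCoeffsOn.unique (h : HasCoeffsOn f N c) (h' : HasCoeffsOn f N c')
    {α : ℕ →₀ ℕ} (hα : α ∈ Set.range (padIndex (N := N))) : c α = c' α := by
  obtain ⟨α, rfl⟩ := hα
  set r : Fin N → ℝ := fun j => (weight k j)⁻¹ / 2
  have hr : ∀ j : Fin N, 0 < r j ∧ r j < (weight k j)⁻¹ := fun j =>
    ⟨half_pos (inv_pos.2 (weight_pos k j)), half_lt_self (inv_pos.2 (weight_pos k j))⟩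
  have hprod : (α.prod fun j m => (r j : ℂ) ^ m) ≠ 0 :=
    Finset.prod_ne_zero_iff.2 fun j _ => pow_ne_zero _ (by exact_mod_cast (hr j).1.ne')
  have hcoeff := fun {b : (ℕ →₀ ℕ) → ℂ} (hb : HasCoeffsOn f N b) =>
    integral_star_mul_eq_coeff orthonormal_torusMonomial (hb.summable_norm hr)
      (hb.hasSum_onTorus hr) α
  exact mul_right_cancel₀ hprod ((hcoeff h).symm.trans (hcoeff h'))

lemma HasMonomialCoeffs.unique (h : HasMonomialCoeffs f c) (h' : HasMonomialCoeffs f c') :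
    c = c' := by
  ext α
  obtain ⟨N, hN⟩ := exists_mem_range_padIndex α
  exact HasCoeffsOn.unique (h N) (h' N) hN

lemma IsHolomorphic.differentiableOn_padZero (hf : IsHolomorphic k f) (N : ℕ) :
    DifferentiableOn ℂ (fun w => zeroExt f (padZero N w))
      (polydisc fun j : Fin N => (weight k j)⁻¹) := by
  intro w hw
  have hmem : WeightedL2.seq k (padL2 k N w) ∈ Omega k := by
    rw [seq_padL2]
    exact padZero_mem_Omega fun j => norm_mul_weight_lt_one_iff.2 (hw j)
  have hpad : DifferentiableAt ℂ (padL2 k N) w :=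
    (LinearMap.toContinuousLinearMap (padL2 k N)).differentiableAt
  exact ((hf _ hmem).comp w hpad).differentiableWithinAt

lemma IsHolomorphic.exists_hasCoeffsOn (hf : IsHolomorphic k f) (N : ℕ) :
    ∃ c, HasCoeffsOn f N c := by
  obtain ⟨c, hc⟩ := exists_hasSum_polydisc (fun j : Fin N => inv_pos.2 (weight_pos k j))
    (hf.differentiableOn_padZero N)
  refine ⟨Function.extend padIndex c 0, fun z hz => (hasSum_padIndex_iff hz).1 ?_⟩
  have hsum := hc (fun j => (z : ℕ → ℂ) j) fun j =>
    norm_mul_weight_lt_one_iff.1 (norm_lt_one_of_mem_Omega z.2 j)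
  simpa only [padIndex_injective.extend_apply, padZero_eq_self hz, zeroExt_apply] using hsum

theorem IsHolomorphic.exists_hasMonomialCoeffs (hf : IsHolomorphic k f) :
    ∃ c, HasMonomialCoeffs f c := by
  choose c hc using hf.exists_hasCoeffsOn
  choose n hn using exists_mem_range_padIndex
  refine ⟨fun α => c (n α) α, fun N z hz => (hasSum_padIndex_iff hz).1 ?_⟩
  refine ((hasSum_padIndex_iff hz).2 (hc N z hz)).congr_fun fun α => ?_
  congr 1
  rcases le_total N (n (padIndex α)) with h | h
  · exact ((hc _).mono h).unique (hc N) ⟨α, rfl⟩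
  · exact (hc _).unique ((hc N).mono h) (hn _)

end Coefficients

section HardyNorm

variable {k : ℕ+} {f : Omega k → ℂ} {N : ℕ} {c : (ℕ →₀ ℕ) → ℂ} {r : Fin N → ℝ}

/-- The monomial coefficients with respect to the variables `zⱼ 𝔭ⱼ^{1/k}`. -/
noncomputable def scaledCoeff (k : ℕ+) (c : (ℕ →₀ ℕ) → ℂ) (α : ℕ →₀ ℕ) : ℂ :=
  c α / ((α.prod fun j m => weight k j ^ m : ℝ) : ℂ)

lemma scaledCoeff_mul_prod {ι : Type*} (e : ι ↪ ℕ) (α : ι →₀ ℕ) (z : ι → ℂ) :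
    (scaledCoeff k c (α.embDomain e) * α.prod fun i m => (z i * weight k (e i)) ^ m) =
      c (α.embDomain e) * α.prod fun i m => z i ^ m := by
  have hprod : (α.prod fun i m => (weight k (e i) : ℂ) ^ m) ≠ 0 :=
    Finset.prod_ne_zero_iff.2 fun i _ =>
      pow_ne_zero _ (by exact_mod_cast (weight_pos k (e i)).ne')
  have hcast : (((α.embDomain e).prod fun j m => weight k j ^ m : ℝ) : ℂ) =
      α.prod fun i m => (weight k (e i) : ℂ) ^ m := by
    rw [Finsupp.prod_embDomain]
    simp [Finsupp.prod]
  simp only [mul_pow, Finsupp.prod_mul, scaledCoeff, hcast]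
  field_simp

lemma HasMonomialCoeffs.eLpNorm_onTorus_sq (h : HasMonomialCoeffs f c)
    (hr : ∀ j, 0 < r j ∧ r j < (weight k j)⁻¹) :
    eLpNorm (onTorus f N r) 2 (torusMeasure (Fin N)) ^ 2 =
      ∑' α : Fin N →₀ ℕ, ‖scaledCoeff k c (padIndex α) *
        α.prod fun j m => ((r j : ℂ) * weight k j) ^ m‖ₑ ^ 2 := by
  rw [eLpNorm_sq_eq_tsum_coeff orthonormal_torusMonomial (HasCoeffsOn.summable_norm (h N) hr)
    (HasCoeffsOn.hasSum_onTorus (h N) hr)]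
  exact tsum_congr fun α => by
    rw [padIndex, ← scaledCoeff_mul_prod (k := k) Fin.valEmbedding α fun j => (r j : ℂ)]
    rfl

lemma HasMonomialCoeffs.hardyENorm_sq_le (h : HasMonomialCoeffs f c) :
    hardyENorm k f ^ 2 ≤ ∑' α, ‖scaledCoeff k c α‖ₑ ^ 2 := by
  simp only [hardyENorm, ENNReal.iSup_pow_of_ne_zero two_ne_zero]
  refine iSup₂_le fun N _ => iSup₂_le fun r hr => ?_
  have hprod : ∀ α : Fin N →₀ ℕ,
      ‖α.prod fun j m => ((r j : ℂ) * weight k j) ^ m‖ₑ ≤ 1 := fun α => by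
    rw [← ofReal_norm, ENNReal.ofReal_le_one, Finsupp.prod, norm_prod]
    refine Finset.prod_le_one (fun j _ => norm_nonneg _) fun j _ => ?_
    rw [norm_pow]
    refine pow_le_one₀ (norm_nonneg _) (norm_mul_weight_lt_one_iff.2 ?_).le
    rw [Complex.norm_real, Real.norm_of_nonneg (hr j).1.le]
    exact (hr j).2
  calc eLpNorm (onTorus f N r) 2 (torusMeasure (Fin N)) ^ 2
      = ∑' α : Fin N →₀ ℕ, ‖scaledCoeff k c (padIndex α) *
          α.prod fun j m => ((r j : ℂ) * weight k j) ^ m‖ₑ ^ 2 := h.eLpNorm_onTorus_sq hr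
    _ ≤ ∑' α : Fin N →₀ ℕ, ‖scaledCoeff k c (padIndex α)‖ₑ ^ 2 := by
        refine ENNReal.tsum_le_tsum fun α => pow_le_pow_left' ?_ 2
        rw [enorm_mul]
        exact mul_le_of_le_one_right' (hprod α)
    _ ≤ ∑' α, ‖scaledCoeff k c α‖ₑ ^ 2 :=
        ENNReal.tsum_comp_le_tsum_of_injective padIndex_injective _

lemma HasMonomialCoeffs.sum_dilate_le_hardyENorm_sq (h : HasMonomialCoeffs f c)
    (S : Finset (ℕ →₀ ℕ)) {ρ : ℝ} (hρ : ρ ∈ Set.Ioo 0 1) :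
    ∑ α ∈ S, ‖scaledCoeff k c α * α.prod fun _ m => (ρ : ℂ) ^ m‖ₑ ^ 2 ≤
      hardyENorm k f ^ 2 := by
  obtain ⟨N, hN, hS⟩ := exists_subset_range_padIndex S
  set r : Fin N → ℝ := fun j => ρ * (weight k j)⁻¹
  have hr : ∀ j : Fin N, 0 < r j ∧ r j < (weight k j)⁻¹ := fun j =>
    ⟨mul_pos hρ.1 (inv_pos.2 (weight_pos k j)),
      mul_lt_of_lt_one_left (inv_pos.2 (weight_pos k j)) hρ.2⟩
  have hle : eLpNorm (onTorus f N r) 2 (torusMeasure (Fin N)) ≤ hardyENorm k f :=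
    le_iSup₂_of_le N hN (le_iSup₂_of_le r hr le_rfl)
  have hrρ : ∀ j : Fin N, (r j : ℂ) * weight k j = ρ := fun j => by
    rw [← Complex.ofReal_mul, inv_mul_cancel_right₀ (weight_pos k j).ne']
  calc ∑ α ∈ S, ‖scaledCoeff k c α * α.prod fun _ m => (ρ : ℂ) ^ m‖ₑ ^ 2
      = ∑ α ∈ S.preimage padIndex padIndex_injective.injOn,
          ‖scaledCoeff k c (padIndex α) * (padIndex α).prod fun _ m => (ρ : ℂ) ^ m‖ₑ ^ 2 :=
        (Finset.sum_preimage _ _ _ _ fun α hα hα' => absurd (hS α hα) hα').symm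
    _ ≤ ∑' α : Fin N →₀ ℕ,
          ‖scaledCoeff k c (padIndex α) * (padIndex α).prod fun _ m => (ρ : ℂ) ^ m‖ₑ ^ 2 :=
        ENNReal.sum_le_tsum _
    _ = eLpNorm (onTorus f N r) 2 (torusMeasure (Fin N)) ^ 2 := by
        simp only [h.eLpNorm_onTorus_sq hr, hrρ, prod_padIndex]
    _ ≤ hardyENorm k f ^ 2 :=
        pow_le_pow_left' hle 2

theorem HasMonomialCoeffs.hardyENorm_sq (h : HasMonomialCoeffs f c) :
    hardyENorm k f ^ 2 = ∑' α, ‖scaledCoeff k c α‖ₑ ^ 2 := by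
  refine h.hardyENorm_sq_le.antisymm ?_
  rw [ENNReal.tsum_eq_iSup_sum]
  refine iSup_le fun S => ?_
  have hcont : Continuous fun ρ : ℝ =>
      ∑ α ∈ S, ‖scaledCoeff k c α * α.prod fun _ m => (ρ : ℂ) ^ m‖ₑ ^ 2 :=
    continuous_finsetSum _ fun α _ => (ENNReal.continuous_pow 2).comp (continuous_enorm.comp
      (continuous_const.mul (continuous_finsetProd _ fun j _ => by fun_prop)))
  have hlim := (hcont.tendsto 1).mono_left (nhdsWithin_le_nhds (s := Set.Iio 1))
  simp only [Complex.ofReal_one, one_pow, Finsupp.prod, Finset.prod_const_one, mul_one] at hlim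
  refine le_of_tendsto hlim ?_
  filter_upwards [Ioo_mem_nhdsLT (zero_lt_one (α := ℝ))] with ρ hρ
  exact h.sum_dilate_le_hardyENorm_sq S hρ

end HardyNorm

section CauchySchwarz

variable {ι R : Type*} [NormedRing R] {a u : ι → R} {K : ℝ}

lemma sum_norm_mul_le_sqrt_mul_sqrt (ha : Summable fun i => ‖a i‖ ^ 2)
    (hu : ∀ S : Finset ι, ∑ i ∈ S, ‖u i‖ ^ 2 ≤ K) (S : Finset ι) :
    ∑ i ∈ S, ‖a i * u i‖ ≤ √(∑' i, ‖a i‖ ^ 2) * √K :=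
  calc ∑ i ∈ S, ‖a i * u i‖ ≤ ∑ i ∈ S, ‖a i‖ * ‖u i‖ := Finset.sum_le_sum fun _ _ => norm_mul_le _ _
    _ ≤ √(∑ i ∈ S, ‖a i‖ ^ 2) * √(∑ i ∈ S, ‖u i‖ ^ 2) := Real.sum_mul_le_sqrt_mul_sqrt S _ _
    _ ≤ √(∑' i, ‖a i‖ ^ 2) * √K := by
        gcongr
        · exact ha.sum_le_tsum S fun i _ => by positivity
        · exact hu S

lemma summable_norm_mul_of_sq (ha : Summable fun i => ‖a i‖ ^ 2)
    (hu : ∀ S : Finset ι, ∑ i ∈ S, ‖u i‖ ^ 2 ≤ K) : Summable fun i => ‖a i * u i‖ :=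
  summable_of_sum_le (fun _ => norm_nonneg _) (sum_norm_mul_le_sqrt_mul_sqrt ha hu)

lemma norm_tsum_mul_le_sqrt_mul_sqrt (ha : Summable fun i => ‖a i‖ ^ 2)
    (hu : ∀ S : Finset ι, ∑ i ∈ S, ‖u i‖ ^ 2 ≤ K) :
    ‖∑' i, a i * u i‖ ≤ √(∑' i, ‖a i‖ ^ 2) * √K :=
  calc ‖∑' i, a i * u i‖ ≤ ∑' i, ‖a i * u i‖ :=
        norm_tsum_le_tsum_norm (summable_norm_mul_of_sq ha hu)
    _ ≤ √(∑' i, ‖a i‖ ^ 2) * √K :=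
        Real.tsum_le_of_sum_le (fun _ => norm_nonneg _) (sum_norm_mul_le_sqrt_mul_sqrt ha hu)

lemma tendstoUniformlyOn_tsum_mul_of_sq [CompleteSpace R] {X : Type*} {V : Set X} {u : ι → X → R}
    (ha : Summable fun i => ‖a i‖ ^ 2)
    (hu : ∀ x ∈ V, ∀ S : Finset ι, ∑ i ∈ S, ‖u i x‖ ^ 2 ≤ K) :
    TendstoUniformlyOn (fun (S : Finset ι) x => ∑ i ∈ S, a i * u i x)
      (fun x => ∑' i, a i * u i x) atTop V := by
  have htail : Tendsto (fun S : Finset ι => √(∑' i : {i // i ∉ S}, ‖a i‖ ^ 2) * √K) atTop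
      (𝓝 0) := by
    simpa using ((tendsto_tsum_compl_atTop_zero fun i => ‖a i‖ ^ 2).sqrt).mul_const √K
  rw [Metric.tendstoUniformlyOn_iff]
  intro ε hε
  filter_upwards [htail.eventually_lt_const hε] with S hS x hx
  rw [dist_eq_norm, ← (summable_norm_mul_of_sq ha (hu x hx)).of_norm.sum_add_tsum_subtype_compl S,
    add_sub_cancel_left]
  refine (norm_tsum_mul_le_sqrt_mul_sqrt (ha.subtype _) fun T => ?_).trans_lt hS
  simpa using hu x hx (T.map (Function.Embedding.subtype _))

end CauchySchwarz

section Series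

variable {k : ℕ+} {c : (ℕ →₀ ℕ) → ℂ}

/-- The sum of the power series with coefficients `c` at the point `z`. -/
noncomputable def monomialSum (c : (ℕ →₀ ℕ) → ℂ) (z : ℕ → ℂ) : ℂ :=
  ∑' α : ℕ →₀ ℕ, c α * α.prod fun j m => z j ^ m

lemma WeightedL2.norm_apply_le (y : WeightedL2 k) (j : ℕ) :
    ‖WeightedL2.seq k y j * weight k j‖ ≤ ‖y‖ :=
  lp.norm_apply_le_norm two_ne_zero (WeightedL2.toLp k y) j

lemma WeightedL2.hasSum_sq (y : WeightedL2 k) :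
    HasSum (fun j => ‖WeightedL2.seq k y j * weight k j‖ ^ 2) (‖y‖ ^ 2) := by
  have hsum := lp.hasSum_norm (p := 2) (by simp) (WeightedL2.toLp k y)
  simp only [ENNReal.toReal_ofNat, Real.rpow_ofNat] at hsum
  exact hsum

lemma WeightedL2.differentiable_seq (j : ℕ) :
    Differentiable ℂ fun y : WeightedL2 k => WeightedL2.seq k y j := by
  refine (((LinearMap.proj j).comp (WeightedL2.seq k)).mkContinuous (weight k j)⁻¹
    fun y => ?_).differentiable
  have hy := y.norm_apply_le j
  rwa [norm_mul, Complex.norm_real, Real.norm_of_nonneg (weight_pos k j).le,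
    ← le_div_iff₀ (weight_pos k j), div_eq_inv_mul] at hy

lemma WeightedL2.differentiable_prod (α : ℕ →₀ ℕ) :
    Differentiable ℂ fun y : WeightedL2 k => α.prod fun j m => WeightedL2.seq k y j ^ m := by
  classical
  exact fun y => (HasFDerivAt.finsetProd fun j _ =>
    ((WeightedL2.differentiable_seq j y).fun_pow (α j)).hasFDerivAt).differentiableAt

lemma WeightedL2.sum_prod_sq_le {y : WeightedL2 k} {ρ : ℝ} (hρ0 : 0 ≤ ρ) (hρ : ρ < 1)
    (hy : ∀ j, ‖WeightedL2.seq k y j * weight k j‖ ≤ ρ) (S : Finset (ℕ →₀ ℕ)) :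
    ∑ α ∈ S, ‖α.prod fun j m => (WeightedL2.seq k y j * weight k j) ^ m‖ ^ 2 ≤
      Real.exp (‖y‖ ^ 2 / (1 - ρ ^ 2)) := by
  have h := sum_prod_pow_le_exp_tsum (x := fun j => ‖WeightedL2.seq k y j * weight k j‖ ^ 2)
    (fun j => by positivity) (fun j => pow_le_pow_left₀ (norm_nonneg _) (hy j) 2)
    (pow_lt_one₀ hρ0 hρ two_ne_zero) y.hasSum_sq.summable S
  rw [y.hasSum_sq.tsum_eq] at h
  simpa only [Finsupp.prod, norm_prod, norm_pow, ← Finset.prod_pow, pow_right_comm _ 2] using h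

lemma WeightedL2.exists_le_of_mem_Omega {y : WeightedL2 k} (hy : WeightedL2.seq k y ∈ Omega k) :
    ∃ ρ : ℝ, 0 ≤ ρ ∧ ρ < 1 ∧ ∀ j, ‖WeightedL2.seq k y j * weight k j‖ ≤ ρ :=
  ⟨_, (norm_nonneg _).trans (le_ciSup hy.2.1 0), hy.2.2, le_ciSup hy.2.1⟩

lemma WeightedL2.mem_Omega_of_le {y : WeightedL2 k} {ρ : ℝ} (hρ : ρ < 1)
    (hy : ∀ j, ‖WeightedL2.seq k y j * weight k j‖ ≤ ρ) : WeightedL2.seq k y ∈ Omega k :=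
  ⟨y.2, ⟨ρ, Set.forall_mem_range.2 hy⟩, (ciSup_le hy).trans_lt hρ⟩

lemma WeightedL2.exists_nhds_sum_prod_sq_le {y : WeightedL2 k}
    (hy : WeightedL2.seq k y ∈ Omega k) :
    ∃ V ∈ 𝓝 y, ∃ K : ℝ, ∀ w ∈ V, WeightedL2.seq k w ∈ Omega k ∧ ∀ S : Finset (ℕ →₀ ℕ),
      ∑ α ∈ S, ‖α.prod fun j m => (WeightedL2.seq k w j * weight k j) ^ m‖ ^ 2 ≤ K := by
  obtain ⟨ρ, hρ0, hρ, hyρ⟩ := WeightedL2.exists_le_of_mem_Omega hy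
  obtain ⟨δ, hδ, hδρ⟩ : ∃ δ > 0, ρ + δ < 1 := ⟨(1 - ρ) / 2, by linarith, by linarith⟩
  refine ⟨Metric.ball y δ, Metric.ball_mem_nhds y hδ,
    Real.exp ((‖y‖ + δ) ^ 2 / (1 - (ρ + δ) ^ 2)), fun w hw => ?_⟩
  have hwy : ‖w - y‖ ≤ δ := (mem_ball_iff_norm.1 hw).le
  have hwρ : ∀ j, ‖WeightedL2.seq k w j * weight k j‖ ≤ ρ + δ := fun j => by
    have hsplit : WeightedL2.seq k w j * weight k j = WeightedL2.seq k y j * weight k j +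
        WeightedL2.seq k (w - y) j * weight k j := by
      rw [map_sub, Pi.sub_apply]
      ring
    rw [hsplit]
    exact (norm_add_le _ _).trans (add_le_add (hyρ j) (((w - y).norm_apply_le j).trans hwy))
  have hw' : ‖w‖ ≤ ‖y‖ + δ := (norm_le_norm_add_norm_sub' w y).trans (by gcongr)
  have hpos : 0 < 1 - (ρ + δ) ^ 2 := sub_pos.2 (pow_lt_one₀ (by positivity) hδρ two_ne_zero)
  refine ⟨WeightedL2.mem_Omega_of_le hδρ hwρ, fun S => ?_⟩
  exact (WeightedL2.sum_prod_sq_le (by positivity) hδρ hwρ S).trans (by gcongr)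

lemma scaledCoeff_mul_prod_weight (α : ℕ →₀ ℕ) (z : ℕ → ℂ) :
    (scaledCoeff k c α * α.prod fun j m => (z j * weight k j) ^ m) =
      c α * α.prod fun j m => z j ^ m := by
  simpa only [Finsupp.embDomain_refl, id, Function.Embedding.refl_apply] using
    scaledCoeff_mul_prod (k := k) (c := c) (Function.Embedding.refl ℕ) α z

theorem hasSum_monomialSum (hc : Summable fun α => ‖scaledCoeff k c α‖ ^ 2) {z : ℕ → ℂ}
    (hz : z ∈ Omega k) :
    HasSum (fun α : ℕ →₀ ℕ => c α * α.prod fun j m => z j ^ m) (monomialSum c z) := by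
  obtain ⟨V, hV, K, hK⟩ := WeightedL2.exists_nhds_sum_prod_sq_le (y := ⟨z, hz.1⟩) hz
  have hsum := summable_norm_mul_of_sq hc (hK _ (mem_of_mem_nhds hV)).2
  exact (hsum.of_norm.congr fun α => (scaledCoeff_mul_prod_weight α z)).hasSum

theorem isHolomorphic_monomialSum (hc : Summable fun α => ‖scaledCoeff k c α‖ ^ 2) :
    IsHolomorphic k fun z => monomialSum c z := by
  intro y hy
  obtain ⟨V, hV, K, hK⟩ := WeightedL2.exists_nhds_sum_prod_sq_le hy
  have hunif := tendstoUniformlyOn_tsum_mul_of_sq hc fun w hw => (hK w hw).2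
  simp only [scaledCoeff_mul_prod_weight] at hunif
  refine (differentiableAt_of_tendstoUniformlyOn hV (fun S => ?_) hunif).congr_of_eventuallyEq ?_
  · exact (Differentiable.fun_sum fun α _ =>
      (WeightedL2.differentiable_prod α).const_mul (c α)).differentiableOn
  · filter_upwards [hV] with w hw
    exact zeroExt_apply (fun z : Omega k => monomialSum c z) ⟨_, (hK w hw).1⟩

lemma hasMonomialCoeffs_monomialSum (hc : Summable fun α => ‖scaledCoeff k c α‖ ^ 2) :
    HasMonomialCoeffs (fun z : Omega k => monomialSum c z) c :=
  fun _ z _ => hasSum_monomialSum hc z.2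

lemma tsum_enorm_sq_lt_top_iff {ι E : Type*} [SeminormedAddCommGroup E] {b : ι → E} :
    ∑' i, ‖b i‖ₑ ^ 2 < ∞ ↔ Summable fun i => ‖b i‖ ^ 2 := by
  simp only [enorm_eq_nnnorm, ← ENNReal.coe_pow, lt_top_iff_ne_top,
    ENNReal.tsum_coe_ne_top_iff_summable, ← NNReal.summable_coe, NNReal.coe_pow, coe_nnnorm]

variable {f : Omega k → ℂ}

lemma HasMonomialCoeffs.hardyENorm_lt_top_iff (h : HasMonomialCoeffs f c) :
    hardyENorm k f < ∞ ↔ Summable fun α => ‖scaledCoeff k c α‖ ^ 2 := by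
  rw [← tsum_enorm_sq_lt_top_iff, ← h.hardyENorm_sq, ENNReal.pow_lt_top_iff]
  simp

lemma HasMonomialCoeffs.toReal_hardyENorm_sq (h : HasMonomialCoeffs f c) :
    (hardyENorm k f).toReal ^ 2 = ∑' α, ‖scaledCoeff k c α‖ ^ 2 := by
  rw [← ENNReal.toReal_pow, h.hardyENorm_sq, ENNReal.tsum_toReal_eq fun α => by finiteness]
  simp only [ENNReal.toReal_pow, toReal_enorm]

lemma monomialSum_mem_hardyFunctions (hc : Summable fun α => ‖scaledCoeff k c α‖ ^ 2) :
    (fun z : Omega k => monomialSum c z) ∈ hardyFunctions k :=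
  ⟨isHolomorphic_monomialSum hc, (hasMonomialCoeffs_monomialSum hc).hardyENorm_lt_top_iff.2 hc⟩

/- The coefficients of `f` are determined on finitely supported points only, so `f` has to be
compared with `monomialSum c` through the Hardy norm of the difference. -/
theorem exists_eq_monomialSum (hf : f ∈ hardyFunctions k) :
    ∃ c, HasMonomialCoeffs f c ∧ Summable (fun α => ‖scaledCoeff k c α‖ ^ 2) ∧
      f = fun z : Omega k => monomialSum c z := by
  obtain ⟨c, hc⟩ := IsHolomorphic.exists_hasMonomialCoeffs hf.1
  have hs := hc.hardyENorm_lt_top_iff.1 hf.2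
  have hdiff : HasMonomialCoeffs (f - fun z : Omega k => monomialSum c z) 0 := fun N z hz => by
    simpa using (hc N z hz).sub (hasMonomialCoeffs_monomialSum hs N z hz)
  have hnorm : hardyENorm k (f - fun z : Omega k => monomialSum c z) = 0 := by
    simpa [scaledCoeff] using hdiff.hardyENorm_sq
  exact ⟨c, hc, hs, sub_eq_zero.1 <|
    eq_zero_of_hardyENorm_eq_zero (sub_mem hf (monomialSum_mem_hardyFunctions hs)).1 hnorm⟩

end Series

section PrimePowers

lemma primeSeq_prime (j : ℕ) : (primeSeq j).Prime :=
  Nat.nth_mem_of_infinite Nat.infinite_setOfPred_prime j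

/-- The enumeration of the primes as an embedding. -/
noncomputable def primeSeqEmbedding : ℕ ↪ ℕ :=
  ⟨primeSeq, Nat.nth_injective Nat.infinite_setOfPred_prime⟩

lemma mem_range_primeSeqEmbedding {p : ℕ} (hp : p.Prime) : p ∈ Set.range primeSeqEmbedding :=
  (Nat.range_nth_of_infinite Nat.infinite_setOfPred_prime).ge hp

lemma coe_primePow (α : ℕ →₀ ℕ) :
    (primePow α : ℕ) = (α.embDomain primeSeqEmbedding).prod (· ^ ·) := by
  rw [Finsupp.prod_embDomain]
  rfl

lemma factorization_primePow (α : ℕ →₀ ℕ) :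
    (primePow α : ℕ).factorization = α.embDomain primeSeqEmbedding := by
  rw [coe_primePow]
  refine Nat.prod_pow_factorization_eq_self fun p hp => ?_
  rw [Finsupp.support_embDomain, Finset.mem_map] at hp
  obtain ⟨j, -, rfl⟩ := hp
  exact primeSeq_prime j

lemma primePow_injective : Function.Injective primePow := fun α β h =>
  Finsupp.embDomain_injective primeSeqEmbedding <| by
    rw [← factorization_primePow, h, factorization_primePow]

lemma primePow_surjective : Function.Surjective primePow := fun n => by
  obtain ⟨α, hα⟩ := (Finsupp.mem_range_embDomain_iff primeSeqEmbedding (n : ℕ).factorization).2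
    fun p hp => mem_range_primeSeqEmbedding (Nat.prime_of_mem_primeFactors hp)
  refine ⟨α, PNat.eq ?_⟩
  rw [coe_primePow, hα]
  exact Nat.prod_factorization_pow_eq_self n.ne_zero

/-- Bohr's correspondence `α ↦ 𝔭^α` between the multi-indices and the positive integers. -/
noncomputable def primePowEquiv : (ℕ →₀ ℕ) ≃ ℕ+ :=
  Equiv.ofBijective primePow ⟨primePow_injective, primePow_surjective⟩

lemma primePow_rpow (k : ℕ+) (α : ℕ →₀ ℕ) :
    ((primePow α : ℕ) : ℝ) ^ (1 / (k : ℝ)) = α.prod fun j m => weight k j ^ m := by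
  change ((α.prod fun j m => primeSeq j ^ m : ℕ) : ℝ) ^ (1 / (k : ℝ)) = _
  rw [Finsupp.prod, Nat.cast_prod, ← Real.finsetProd_rpow _ _ fun j _ => by positivity]
  refine Finset.prod_congr rfl fun j _ => ?_
  have hpos : (0 : ℝ) ≤ primeSeq j := Nat.cast_nonneg _
  simp only [Nat.cast_pow, ← Real.rpow_natCast, weight, ← Real.rpow_mul hpos, mul_comm]

lemma scaledCoeff_comp_primePow (k : ℕ+) (a : ℕ+ → ℂ) (α : ℕ →₀ ℕ) :
    scaledCoeff k (a ∘ primePow) α = shiftSeries (1 / (k : ℝ)) a (primePow α) := by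
  rw [scaledCoeff, ← primePow_rpow]
  rfl

lemma comp_primePowEquiv_symm_comp_primePow (c : (ℕ →₀ ℕ) → ℂ) :
    (c ∘ primePowEquiv.symm) ∘ primePow = c :=
  funext fun α => congrArg c (primePowEquiv.symm_apply_apply α)

end PrimePowers

section DirichletToHardy

variable {k : ℕ+}

lemma mem_h2kSeries_iff {a : ℕ+ → ℂ} :
    a ∈ h2kSeries k ↔ Summable fun α => ‖scaledCoeff k (a ∘ primePow) α‖ ^ 2 := by
  change shiftSeries (1 / (k : ℝ)) a ∈ h2Series ↔ _
  rw [mem_h2Series_iff, memℓp_gen_iff (by simp)]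
  simp only [ENNReal.toReal_ofNat, Real.rpow_ofNat, scaledCoeff_comp_primePow]
  exact (primePowEquiv.summable_iff
    (f := fun n => ‖shiftSeries (1 / (k : ℝ)) a n‖ ^ 2)).symm

lemma comp_primePowEquiv_symm_mem_h2kSeries {c : (ℕ →₀ ℕ) → ℂ}
    (hc : Summable fun α => ‖scaledCoeff k c α‖ ^ 2) : c ∘ primePowEquiv.symm ∈ h2kSeries k := by
  rwa [mem_h2kSeries_iff, comp_primePowEquiv_symm_comp_primePow]

lemma DirichletH2k.summable (D : DirichletH2k k) :
    Summable fun α => ‖scaledCoeff k (DirichletH2k.coeffs k D ∘ primePow) α‖ ^ 2 :=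
  mem_h2kSeries_iff.1 D.2

lemma DirichletH2k.coeffs_toH2 (D : DirichletH2k k) :
    DirichletH2.coeffs (DirichletH2k.toH2 k D) =
      shiftSeries (1 / (k : ℝ)) (DirichletH2k.coeffs k D) :=
  congrArg Subtype.val (LinearEquiv.apply_symm_apply
    (LinearEquiv.ofInjective DirichletH2.coeffs DirichletH2.coeffs_injective) _)

lemma DirichletH2k.norm_sq_eq_tsum (D : DirichletH2k k) :
    ‖D‖ ^ 2 = ∑' α, ‖scaledCoeff k (DirichletH2k.coeffs k D ∘ primePow) α‖ ^ 2 := by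
  have hsum := lp.hasSum_norm (p := 2) (by simp) (DirichletH2.toLpCLM (DirichletH2k.toH2 k D))
  simp only [ENNReal.toReal_ofNat, Real.rpow_ofNat, DirichletH2.norm_toLpCLM,
    DirichletH2.toLpCLM_apply, DirichletH2k.coeffs_toH2] at hsum
  simp only [scaledCoeff_comp_primePow]
  exact hsum.tsum_eq.symm.trans (primePowEquiv.tsum_eq _).symm

lemma DirichletH2k.toH2_surjective (k : ℕ+) : Function.Surjective (DirichletH2k.toH2 k) := by
  intro x
  set a : ℕ+ → ℂ := fun n => DirichletH2.coeffs x n * (((n : ℝ) ^ (1 / (k : ℝ)) : ℝ) : ℂ)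
  have hshift : shiftSeries (1 / (k : ℝ)) a = DirichletH2.coeffs x := by
    ext n
    have hn : (((n : ℝ) ^ (1 / (k : ℝ)) : ℝ) : ℂ) ≠ 0 := by
      exact_mod_cast (Real.rpow_pos_of_pos (Nat.cast_pos.2 n.pos) _).ne'
    exact mul_div_cancel_right₀ _ hn
  have hmem : a ∈ h2kSeries k := by
    change shiftSeries (1 / (k : ℝ)) a ∈ h2Series
    rw [hshift]
    exact ⟨x, rfl⟩
  exact ⟨⟨a, hmem⟩, DirichletH2.coeffs_injective ((DirichletH2k.coeffs_toH2 _).trans hshift)⟩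

lemma DirichletH2k.completeSpace (k : ℕ+) : CompleteSpace (DirichletH2k k) := by
  have hiso : Isometry (DirichletH2k.toH2 k) :=
    AddMonoidHomClass.isometry_of_norm _ fun _ => rfl
  exact (hiso.isUniformInducing.completeSpace_congr (DirichletH2k.toH2_surjective k)).2
    inferInstance

lemma monomialSum_add {c d : (ℕ →₀ ℕ) → ℂ} {z : ℕ → ℂ} (hz : z ∈ Omega k)
    (hc : Summable fun α => ‖scaledCoeff k c α‖ ^ 2)
    (hd : Summable fun α => ‖scaledCoeff k d α‖ ^ 2) :
    monomialSum (c + d) z = monomialSum c z + monomialSum d z := by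
  rw [← ((hasSum_monomialSum hc hz).add (hasSum_monomialSum hd hz)).tsum_eq]
  exact tsum_congr fun α => add_mul _ _ _

lemma monomialSum_smul (r : ℂ) (c : (ℕ →₀ ℕ) → ℂ) (z : ℕ → ℂ) :
    monomialSum (r • c) z = r * monomialSum c z := by
  simp only [monomialSum, Pi.smul_apply, smul_eq_mul, mul_assoc, tsum_mul_left]

/-- The isometry of `𝓗²ₖ` into `H²(Ωₖ)` that preserves the coefficients. -/
noncomputable def DirichletH2k.toHardy (k : ℕ+) : DirichletH2k k →ₗᵢ[ℂ] HardyH2 k where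
  toFun D := ⟨fun z => monomialSum (DirichletH2k.coeffs k D ∘ primePow) z,
    monomialSum_mem_hardyFunctions D.summable⟩
  map_add' D E := Subtype.ext (funext fun z => monomialSum_add z.2 D.summable E.summable)
  map_smul' r _ := Subtype.ext (funext fun z => monomialSum_smul r _ z)
  norm_map' D := (pow_left_inj₀ ENNReal.toReal_nonneg (norm_nonneg D) two_ne_zero).1 <|
    (hasMonomialCoeffs_monomialSum D.summable).toReal_hardyENorm_sq.trans D.norm_sq_eq_tsum.symm

lemma DirichletH2k.hasMonomialCoeffs_toHardy (D : DirichletH2k k) :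
    HasMonomialCoeffs (HardyH2.toFun k (DirichletH2k.toHardy k D))
      (DirichletH2k.coeffs k D ∘ primePow) :=
  hasMonomialCoeffs_monomialSum D.summable

lemma DirichletH2k.toHardy_surjective (k : ℕ+) :
    Function.Surjective (DirichletH2k.toHardy k) := by
  intro f
  obtain ⟨c, -, hc, hf⟩ := exists_eq_monomialSum f.2
  refine ⟨⟨_, comp_primePowEquiv_symm_mem_h2kSeries hc⟩, Subtype.ext (Eq.trans ?_ hf.symm)⟩
  ext z
  exact congrArg (monomialSum · z) (comp_primePowEquiv_symm_comp_primePow c)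

/-- The isometric isomorphism `𝓗²ₖ ≃ H²(Ωₖ)` that preserves the coefficients. -/
noncomputable def DirichletH2k.equivHardy (k : ℕ+) : DirichletH2k k ≃ₗᵢ[ℂ] HardyH2 k :=
  LinearIsometryEquiv.ofSurjective (DirichletH2k.toHardy k) (DirichletH2k.toHardy_surjective k)

lemma HardyH2.completeSpace (k : ℕ+) : CompleteSpace (HardyH2 k) :=
  ((DirichletH2k.toHardy k).isometry.isUniformInducing.completeSpace_congr
    (DirichletH2k.toHardy_surjective k)).1 (DirichletH2k.completeSpace k)

end DirichletToHardy

section ProjectiveLimit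

lemma weight_anti (j : ℕ) : Antitone fun k : ℕ+ => weight k j := fun k l h => by
  have hj : (1 : ℝ) ≤ primeSeq j := by exact_mod_cast primeSeq_pos j
  have hk : (0 : ℝ) < k := Nat.cast_pos.2 k.pos
  have hkl : (k : ℝ) ≤ l := by exact_mod_cast h
  exact Real.rpow_le_rpow_of_exponent_le hj (one_div_le_one_div_of_le hk hkl)

lemma Omega_mono : Monotone Omega := fun k l h z hz => by
  have hle : ∀ j, ‖z j * weight l j‖ ≤ ‖z j * weight k j‖ := fun j => by
    rw [norm_mul, norm_mul, Complex.norm_real, Complex.norm_real,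
      Real.norm_of_nonneg (weight_pos l j).le, Real.norm_of_nonneg (weight_pos k j).le]
    exact mul_le_mul_of_nonneg_left (weight_anti j h) (norm_nonneg _)
  have hle_sup : ∀ j, ‖z j * weight l j‖ ≤ ⨆ j, ‖z j * weight k j‖ := fun j =>
    (hle j).trans (le_ciSup hz.2.1 j)
  exact ⟨Memℓp.mono' (show Memℓp (weightMul k z) 2 from hz.1) hle,
    ⟨_, Set.forall_mem_range.2 hle_sup⟩, (ciSup_le hle_sup).trans_lt hz.2.2⟩

lemma HPlus.summable (D : HPlus) (k : ℕ+) :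
    Summable fun α => ‖scaledCoeff k (HPlus.coeffs D ∘ primePow) α‖ ^ 2 :=
  (HPlus.incl k D).summable

/-- The map of `𝓗₊` into the intersection of the spaces `H²(Ωₖ)` that preserves the
coefficients. -/
noncomputable def HPlus.toHardyInter : HPlus →ₗ[ℂ] HardyInter where
  toFun D := ⟨fun z => monomialSum (HPlus.coeffs D ∘ primePow) z,
    (Submodule.mem_iInf _).2 fun k => monomialSum_mem_hardyFunctions (D.summable k)⟩
  map_add' D E := Subtype.ext (funext fun z => by
    obtain ⟨k, hk⟩ := Set.mem_iUnion.1 z.2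
    exact monomialSum_add hk (D.summable k) (E.summable k))
  map_smul' r D := Subtype.ext (funext fun z => monomialSum_smul r _ z)

lemma HPlus.toHardy_toHardyInter (D : HPlus) (k : ℕ+) :
    HardyInter.toHardy k (HPlus.toHardyInter D) = DirichletH2k.toHardy k (HPlus.incl k D) :=
  rfl

lemma HPlus.toHardyInter_injective : Function.Injective HPlus.toHardyInter := fun D E h => by
  have hfirst := congrArg (HardyInter.toHardy 1) h
  rw [HPlus.toHardy_toHardyInter, HPlus.toHardy_toHardyInter] at hfirst
  exact Submodule.inclusion_injective (hplusSeries_le 1)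
    ((DirichletH2k.toHardy 1).injective hfirst)

lemma exists_eq_monomialSum_of_mem_hardyInterFunctions {f : (⋃ k : ℕ+, Omega k) → ℂ}
    (hf : f ∈ hardyInterFunctions) :
    ∃ c, (∀ k, Summable fun α => ‖scaledCoeff k c α‖ ^ 2) ∧
      f = fun z : ⋃ k : ℕ+, Omega k => monomialSum c z := by
  choose c hc hs hfc using fun k : ℕ+ => exists_eq_monomialSum ((Submodule.mem_iInf _).1 hf k)
  have hconst : ∀ k, c k = c 1 := fun k =>
    HasMonomialCoeffs.unique (f := restrictOmega 1 f)
      (fun N z hz => hc k N ⟨z, Omega_mono (one_le (a := k)) z.2⟩ hz) (hc 1)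
  refine ⟨c 1, fun k => hconst k ▸ hs k, funext fun z => ?_⟩
  obtain ⟨k, hk⟩ := Set.mem_iUnion.1 z.2
  rw [← hconst k]
  exact congrFun (hfc k) ⟨z, hk⟩

lemma HPlus.toHardyInter_surjective : Function.Surjective HPlus.toHardyInter := by
  intro f
  obtain ⟨c, hc, hf⟩ := exists_eq_monomialSum_of_mem_hardyInterFunctions f.2
  have hmem : c ∘ primePowEquiv.symm ∈ hplusSeries :=
    (hplus_iff _).2 ((Submodule.mem_iInf _).2 fun k => comp_primePowEquiv_symm_mem_h2kSeries (hc k))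
  refine ⟨⟨_, hmem⟩, Subtype.ext (Eq.trans ?_ hf.symm)⟩
  ext z
  exact congrArg (monomialSum · z) (comp_primePowEquiv_symm_comp_primePow c)

lemma HPlus.topology_eq_iInf_induced : (inferInstance : TopologicalSpace HPlus) =
    ⨅ k : ℕ+, TopologicalSpace.induced (HPlus.incl k) inferInstance := by
  have hp : WithSeminorms HPlus.seminorms := ⟨rfl⟩
  have := hp.topologicalAddGroup
  refine (HPlus.seminorms.withSeminorms_iff_topologicalSpace_eq_iInf.1 hp).trans
    (iInf_congr fun k => ?_)
  let _ := (HPlus.seminorms k).toSeminormedAddCommGroup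
  have hiso : Isometry (HPlus.incl k) := AddMonoidHomClass.isometry_of_norm _ fun _ => rfl
  exact @IsInducing.eq_induced _ _ (_) (_) _
    (@IsUniformInducing.isInducing _ _ (_) (_) _ hiso.isUniformInducing)

lemma HPlus.isInducing_toHardyInter : IsInducing HPlus.toHardyInter := by
  refine ⟨HPlus.topology_eq_iInf_induced.trans ?_⟩
  change _ = TopologicalSpace.induced _ (⨅ k : ℕ+, _)
  rw [induced_iInf]
  refine iInf_congr fun k => ?_
  rw [induced_compose]
  change _ = TopologicalSpace.induced (DirichletH2k.toHardy k ∘ HPlus.incl k) _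
  rw [← induced_compose,
    ← (DirichletH2k.toHardy k).isometry.isUniformInducing.isInducing.eq_induced]

/-- The isomorphism of `𝓗₊` with the intersection of the spaces `H²(Ωₖ)` that preserves the
coefficients. -/
noncomputable def HPlus.equivHardyInter : HPlus ≃L[ℂ] HardyInter :=
  let e := LinearEquiv.ofBijective HPlus.toHardyInter
    ⟨HPlus.toHardyInter_injective, HPlus.toHardyInter_surjective⟩
  { e with
    continuous_toFun := HPlus.isInducing_toHardyInter.continuous
    continuous_invFun :=
      (e.toEquiv.toHomeomorphOfIsInducing HPlus.isInducing_toHardyInter).symm.continuous }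

end ProjectiveLimit

theorem corollary3p6 :
    (∀ k : ℕ+, CompleteSpace (DirichletH2k k) ∧ CompleteSpace (HardyH2 k) ∧
      ∃ Φ : DirichletH2k k ≃ₗᵢ[ℂ] HardyH2 k, ∀ D : DirichletH2k k,
        HasMonomialCoeffs (HardyH2.toFun k (Φ D))
          (fun α => DirichletH2k.coeffs k D (primePow α))) ∧
    ∃ Ψ : HPlus ≃L[ℂ] HardyInter, ∀ (D : HPlus) (k : ℕ+),
      HasMonomialCoeffs (HardyH2.toFun k (HardyInter.toHardy k (Ψ D)))
        (fun α => HPlus.coeffs D (primePow α)) ∧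
      ‖HardyInter.toHardy k (Ψ D)‖ = HPlus.seminorms k D :=
  ⟨fun k => ⟨DirichletH2k.completeSpace k, HardyH2.completeSpace k, DirichletH2k.equivHardy k,
    fun D => D.hasMonomialCoeffs_toHardy⟩,
  HPlus.equivHardyInter, fun D k => ⟨(HPlus.incl k D).hasMonomialCoeffs_toHardy,
    (DirichletH2k.toHardy k).norm_map (HPlus.incl k D)⟩⟩
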